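/- Let $d\ge 1$, and let $F:\mathbb R^d\to\mathbb R$ be differentiable and bounded below, with $\|\nabla F(x)-\nabla F(y)\|\le L\|x-y\|$ for all $x,y$, where $L>0$. N-SGD started at a deterministic $x^1\in\mathbb R^d$ is the iteration $$x^{t+1}=x^t-\alpha_t\Psi(\nabla f(x^t;\xi^t)),\qquad \alpha_t=\frac{a}{(t+1)^\eta},\quad t=1,2,\dots,$$ with $a>0$ and $\eta\in[1/2,1)$, where $f$ is the loss and $\xi^t$ are random samples. Assume the following. (Nonlinearity.) $\Psi:\mathbb R^d\to\mathbb R^d$ is of one of two kinds. Either it is component-wise, $\Psi(x)=(\psi(x_1),\dots,\psi(x_d))$, where $\psi:\mathbb R\to\mathbb R$ is bounded, odd, non-decreasing, strictly increasing on some $(-c,c)$ with $c>0$, and twice continuously differentiable with bounded first and second derivatives. Or it is joint, $\Psi(x)=x\,\varphi(\|x\|)$, where $\varphi:\mathbb R\to\mathbb R$ is continuous except at finitely many points, positive and non-increasing on $(0,\infty)$, and $s\mapsto s\varphi(s)$ is non-decreasing and bounded on $(0,\infty)$. Let $C>0$ satisfy $\|\Psi(y)\|\le C$ for all $y$. (Noise.)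 There are probability densities $P_x$ on $\mathbb R^d$, $x\in\mathbb R^d$, such that for every $t\ge1$ the noise $z^t=\nabla f(x^t;\xi^t)-\nabla F(x^t)$ has conditional density $P_{x^t}$ given $(x^1,\dots,x^t)$. Moreover $P_x(-z)=P_x(z)$ for all $x,z$, and for some $E_0>0$ we have $\inf_x P_x(z)>0$ for every $z$ with $\|z\|\le E_0$. If $d=1$ and $\Psi$ is not of the component-wise kind above, assume in addition that, for some $E_0>0$, $\inf_x\inf_{|z|\le E_0}P_x(z)>0$. No moments of the noise are assumed to exist. Put $\Phi_x(y)=\int\Psi(y+z)P_x(z)\,dz$. Then there are constants $\beta_1,\beta_2>0$, depending only on $\Psi$ and the family $(P_x)$, such that $$\langle\Phi_x(y),y\rangle\ge\min\{\beta_1\|y\|,\beta_2\|y\|^2\}\quad\text{for all }x,y\in\mathbb R^d. \qquad (*)$$ For any such $\beta_1,\beta_2$ put $\beta=\min\{\beta_1,\beta_2\}$ and $\Delta=F(x^1)-\inf F$. If $$a\le\min\Big\{1,\ \frac{\beta_2}{8C^2},\ \frac{(1-\eta)\beta_1}{8C^2\big(LC+(1-\eta)\|\nabla F(x^1)\|\big)}\Big\},$$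 then for every integer $t\ge1$ and every $\delta\in(0,1)$, with probability at least $1-\delta$, $$\frac1t\sum_{k=1}^t\min\{\|\nabla F(x^k)\|,\|\nabla F(x^k)\|^2\}\le\frac{4(\log(1/\delta)+\Delta)}{a\beta t^{1-\eta}}+\frac{2aLC^2}{\beta t^{1-\eta}}\sum_{k=1}^t(k+1)^{-2\eta}.$$ -/

import Mathlib

open MeasureTheory

/-- The space `ℝᵈ` with the Euclidean norm. -/
abbrev Rd (d : ℕ) : Type := EuclideanSpace ℝ (Fin d)

/-- The scalar map of a smooth component-wise nonlinearity: twice continuously differentiable with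
bounded first and second derivatives, non-decreasing, odd, strictly increasing near the origin,
and bounded. (Being `C²`, such a map has no discontinuities.) -/
structure IsSmoothScalar (ψ : ℝ → ℝ) : Prop where
  contDiff : ContDiff ℝ 2 ψ
  deriv_bdd : ∃ K₁ > 0, ∀ s, |deriv ψ s| ≤ K₁
  deriv2_bdd : ∃ K₂ > 0, ∀ s, |deriv (deriv ψ) s| ≤ K₂
  mono : Monotone ψ
  odd : ∀ s, ψ (-s) = -ψ s
  strictMono : ∃ c₂ > 0, StrictMonoOn ψ (Set.Ioo (-c₂) c₂)
  bdd : ∃ C₁ > 0, ∀ s, |ψ s| ≤ C₁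

/-- The scalar map of a joint nonlinearity `x ↦ φ(‖x‖) x`. The last field says that this map is
bounded. -/
structure IsJointScalar (φ : ℝ → ℝ) : Prop where
  cont : {s : ℝ | ¬ ContinuousAt φ s}.Finite
  mono : MonotoneOn (fun s => s * φ s) (Set.Ioi 0)
  anti : AntitoneOn φ (Set.Ioi 0)
  pos : ∀ s, 0 < s → 0 < φ s
  bdd : ∃ C₂ > 0, ∀ s, 0 < s → s * φ s ≤ C₂

/-- `Ψ(x) = (ψ(x₁), …, ψ(x_d))` with a smooth scalar map `ψ`. -/
def IsSmoothComponentwise {d : ℕ} (Ψ : Rd d → Rd d) : Prop :=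
  ∃ ψ : ℝ → ℝ, IsSmoothScalar ψ ∧ ∀ x i, Ψ x i = ψ (x i)

/-- `Ψ(x) = x φ(‖x‖)`. -/
def IsJoint {d : ℕ} (Ψ : Rd d → Rd d) : Prop :=
  ∃ φ : ℝ → ℝ, IsJointScalar φ ∧ ∀ x, Ψ x = φ ‖x‖ • x

/-- A family `P x` (`x ∈ ℝᵈ`) of probability densities on `ℝᵈ`, each symmetric, and uniformly in
`x` positive around the origin. -/
structure IsSymmetricNoiseDensity {d : ℕ} (P : Rd d → Rd d → ℝ) : Prop where
  measurable : Measurable (Function.uncurry P)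
  nonneg : ∀ x z, 0 ≤ P x z
  integral_eq_one : ∀ x, ∫ z, P x z = 1
  symm : ∀ x z, P x (-z) = P x z
  pos : ∃ E₀ > 0, ∀ z, ‖z‖ ≤ E₀ → 0 < ⨅ x, P x z

/-- The denoised nonlinearity `Φ_x(y) = ∫ Ψ(y + z) P_x(z) dz`. -/
noncomputable def denoised {d : ℕ} (P : Rd d → Rd d → ℝ) (Ψ : Rd d → Rd d) (x y : Rd d) : Rd d :=
  ∫ z, P x z • Ψ (y + z)

/-- `β₁, β₂ > 0` are constants with `⟨Φ_x(y), y⟩ ≥ min {β₁ ‖y‖, β₂ ‖y‖²}` for all states `x` and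
all `y`. -/
def AreDenoisingConstants {d : ℕ} (P : Rd d → Rd d → ℝ) (Ψ : Rd d → Rd d) (β₁ β₂ : ℝ) : Prop :=
  0 < β₁ ∧ 0 < β₂ ∧
    ∀ x y : Rd d, min (β₁ * ‖y‖) (β₂ * ‖y‖ ^ 2) ≤ inner ℝ (denoised P Ψ x y) y

/-- `F` is bounded below and differentiable, with `L`-Lipschitz gradient. -/
structure IsSmoothCost {d : ℕ} (F : Rd d → ℝ) (L : ℝ) : Prop where
  bddBelow : BddBelow (Set.range F)
  differentiable : Differentiable ℝ F
  lipschitz : ∀ x y, ‖gradient F x - gradient F y‖ ≤ L * ‖x - y‖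

/-- The stochastic gradient `∇f(x; s)`, with the gradient taken in `x`. -/
noncomputable def stochGrad {d : ℕ} {Ξ : Type*} (f : Rd d → Ξ → ℝ) (x : Rd d) (s : Ξ) : Rd d :=
  gradient (fun y => f y s) x

/-- `x¹, x², …` are the iterates of nonlinear SGD started at the deterministic point `x₁`:
`x^{t+1} = x^t - α_t Ψ(∇f(x^t; ξ^t))`. Time starts at `1`; the value `x 0` plays no role. -/
structure IsNSGD {d : ℕ} {Ω Ξ : Type*} (f : Rd d → Ξ → ℝ) (ξ : ℕ → Ω → Ξ) (Ψ : Rd d → Rd d)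
    (α : ℕ → ℝ) (x₁ : Rd d) (x : ℕ → Ω → Rd d) : Prop where
  init : ∀ ω, x 1 ω = x₁
  step : ∀ t, 1 ≤ t → ∀ ω, x (t + 1) ω = x t ω - α t • Ψ (stochGrad f (x t ω) (ξ t ω))

/-- The natural filtration `σ(x¹, …, x^t)`. -/
@[reducible] def history {d : ℕ} {Ω : Type*} (x : ℕ → Ω → Rd d) (t : ℕ) : MeasurableSpace Ω :=
  ⨆ k ∈ Finset.Icc 1 t, MeasurableSpace.comap (x k) inferInstance

/-- For every `t ≥ 1`, the noise `z^t = ∇f(x^t; ξ^t) - ∇F(x^t)` depends on the past only through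
the current state: conditionally on `σ(x¹, …, x^t)`, it has the density `P_{x^t}`. -/
structure HasNoiseDensity {d : ℕ} {Ω Ξ : Type*} [MeasurableSpace Ω] (μ : Measure Ω)
    (F : Rd d → ℝ) (f : Rd d → Ξ → ℝ) (ξ : ℕ → Ω → Ξ) (x : ℕ → Ω → Rd d)
    (P : Rd d → Rd d → ℝ) : Prop where
  measurable : ∀ t, 1 ≤ t → Measurable fun ω => stochGrad f (x t ω) (ξ t ω)
  condDensity : ∀ t, 1 ≤ t → ∀ B : Set (Rd d), MeasurableSet B →
    μ[{ω | stochGrad f (x t ω) (ξ t ω) - gradient F (x t ω) ∈ B}.indicator (fun _ => (1 : ℝ)) |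
        history x t]
      =ᵐ[μ] fun ω => ∫ z in B, P (x t ω) z

/-! ### Symmetrization of the noise and uniform positivity of the densities -/

section DensityLemmas

variable {d : ℕ} {P : Rd d → Rd d → ℝ} {Ψ : Rd d → Rd d}

/-! Denoising constants. Since each density is even, `two_mul_inner_denoised` writes twice the inner
product of the denoised map with `y` as the integral of `⟪Ψ (y + z) + Ψ (y - z), y⟫` against the
density. This integrand is never negative, so it may be restricted to a small open set of `z` where
it is large and where the densities carry mass uniformly in the state. A component-wise map is
tested near a point with `ψ' > 0` along a large coordinate of `y`; a joint map in dimension at least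
two is tested on `z` far from parallel to `y`. On the line no fixed open set need work, and one
averages over an interval.

High probability. Because `Ψ` is bounded, Hoeffding's lemma controls the exponential moment of one
step, whatever the tails of the noise. Drift and variance proxy thus give an exponential
supermartingale (`lintegral_exp_logSupermartingale_le_one`), and Markov's inequality bounds its
logarithm by `log (1 / δ)` off an event of probability at most `δ`. The rest is pathwise
(`IsSmoothCost.average_le`): bounded steps let the gradient grow at most like `k ^ (1 - η)`, so for
`η ≥ 1/2` and small `a` the variance term is at most half the drift. The descent lemma bounds what
remains. -/

theorem IsSymmetricNoiseDensity.measurable_apply (hP : IsSymmetricNoiseDensity P) (x : Rd d) :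
    Measurable (P x) :=
  hP.measurable.of_uncurry_left

theorem IsSymmetricNoiseDensity.integrable (hP : IsSymmetricNoiseDensity P) (x : Rd d) :
    Integrable (P x) := by
  by_contra h
  have := hP.integral_eq_one x
  rw [integral_undef h] at this
  exact zero_ne_one this

theorem IsSymmetricNoiseDensity.iInf_le (hP : IsSymmetricNoiseDensity P) (x z : Rd d) :
    ⨅ x, P x z ≤ P x z :=
  ciInf_le ⟨0, by rintro _ ⟨x, rfl⟩; exact hP.nonneg x z⟩ x

theorem IsSymmetricNoiseDensity.integrable_smul {E : Type*} [NormedAddCommGroup E]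
    [NormedSpace ℝ E] (hP : IsSymmetricNoiseDensity P) (x : Rd d) {g : Rd d → E}
    (hg : AEStronglyMeasurable g) {C : ℝ} (hC : ∀ z, ‖g z‖ ≤ C) :
    Integrable fun z => P x z • g z :=
  (hP.integrable x).smul_bdd C hg (Filter.Eventually.of_forall hC)

/-- On every nonempty open subset of the ball of positivity, the densities are bounded below,
uniformly in the state, off a set whose volume is uniformly smaller. The infimum over the states
need not be measurable, so continuity of the outer measure from below is used. -/
theorem IsSymmetricNoiseDensity.exists_uniform_volume (hP : IsSymmetricNoiseDensity P) {E₀ : ℝ}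
    (hE : ∀ z, ‖z‖ ≤ E₀ → 0 < ⨅ x, P x z) {U : Set (Rd d)} (hU : IsOpen U) (hne : U.Nonempty)
    (hsub : ∀ z ∈ U, ‖z‖ ≤ E₀) :
    ∃ p > 0, ∃ ε > 0, ∀ x, ε ≤ volume.real (U ∩ {z | p ≤ P x z}) := by
  let A : ℕ → Set (Rd d) := fun n => {z ∈ U | 1 / ((n : ℝ) + 1) ≤ ⨅ x, P x z}
  have hA : Monotone A := fun m n hmn z hz =>
    ⟨hz.1, (one_div_le_one_div_of_le (by positivity) (by gcongr)).trans hz.2⟩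
  have hUnion : ⋃ n, A n = U := by
    apply Set.Subset.antisymm
    · exact Set.iUnion_subset fun n z hz => hz.1
    · intro z hz
      obtain ⟨n, hn⟩ := exists_nat_one_div_lt (hE z (hsub z hz))
      exact Set.mem_iUnion.2 ⟨n, hz, hn.le⟩
  have hpos : 0 < volume (⋃ n, A n) := by rw [hUnion]; exact hU.measure_pos _ hne
  rw [hA.measure_iUnion, lt_iSup_iff] at hpos
  obtain ⟨n, hn⟩ := hpos
  have hfin : volume U < ⊤ :=
    (measure_mono fun z hz => mem_closedBall_zero_iff.2 (hsub z hz)).trans_lt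
      (measure_closedBall_lt_top (x := (0 : Rd d)) (r := E₀))
  have hAfin : volume (A n) ≠ ⊤ := ((measure_mono fun z hz => hz.1).trans_lt hfin).ne
  refine ⟨1 / ((n : ℝ) + 1), by positivity, volume.real (A n), ENNReal.toReal_pos hn.ne' hAfin,
    fun x => measureReal_mono (fun z hz => ⟨hz.1, hz.2.trans (hP.iInf_le x z)⟩)
      ((measure_mono Set.inter_subset_left).trans_lt hfin).ne⟩

theorem inner_symmetrized_bdd {C : ℝ} (hb : ∀ y, ‖Ψ y‖ ≤ C) (y z : Rd d) :
    ‖inner ℝ (Ψ (y + z) + Ψ (y - z)) y‖ ≤ (C + C) * ‖y‖ :=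
  (norm_inner_le_norm _ _).trans
    (mul_le_mul_of_nonneg_right ((norm_add_le _ _).trans (add_le_add (hb _) (hb _)))
      (norm_nonneg y))

theorem IsSymmetricNoiseDensity.integrable_symmetrized (hP : IsSymmetricNoiseDensity P)
    (hm : Measurable Ψ) {C : ℝ} (hb : ∀ y, ‖Ψ y‖ ≤ C) (x y : Rd d) :
    Integrable fun z => P x z * inner ℝ (Ψ (y + z) + Ψ (y - z)) y :=
  hP.integrable_smul x (g := fun z => inner ℝ (Ψ (y + z) + Ψ (y - z)) y)
    (by fun_prop) (inner_symmetrized_bdd hb y)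

/-- The substitution `z ↦ -z` leaves the density unchanged; averaging both forms of the integral
makes the integrand pointwise nonnegative for the nonlinearities considered here. -/
theorem two_mul_inner_denoised (hP : IsSymmetricNoiseDensity P) (hm : Measurable Ψ) {C : ℝ}
    (hb : ∀ y, ‖Ψ y‖ ≤ C) (x y : Rd d) :
    2 * inner ℝ (denoised P Ψ x y) y = ∫ z, P x z * inner ℝ (Ψ (y + z) + Ψ (y - z)) y := by
  have h1 : Integrable fun z => P x z • Ψ (y + z) :=
    hP.integrable_smul x (hm.comp (measurable_const_add y)).aestronglyMeasurable fun z => hb _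
  have h2 : Integrable fun z => P x z • Ψ (y - z) :=
    hP.integrable_smul x (hm.comp (measurable_id.const_sub y)).aestronglyMeasurable fun z => hb _
  have h3 : denoised P Ψ x y = ∫ z, P x z • Ψ (y - z) := by
    rw [denoised, ← integral_neg_eq_self]
    simp only [hP.symm, ← sub_eq_add_neg]
  have h4 : (2 : ℝ) • denoised P Ψ x y = ∫ z, P x z • (Ψ (y + z) + Ψ (y - z)) := by
    simp only [smul_add]
    rw [integral_add h1 h2, ← h3, two_smul, denoised]
  have h5 : Integrable fun z => P x z • (Ψ (y + z) + Ψ (y - z)) := by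
    simp only [smul_add]
    exact h1.add h2
  rw [← real_inner_smul_left, h4, real_inner_comm, ← integral_inner h5]
  simp only [real_inner_smul_right, real_inner_comm]

/-- Denoising constants exist as soon as the symmetrized nonlinearity has a nonnegative component
along `y`, with the right lower bound on one of finitely many open sets. -/
theorem exists_areDenoisingConstants_of_open (hP : IsSymmetricNoiseDensity P) (hm : Measurable Ψ)
    {C : ℝ} (hb : ∀ y, ‖Ψ y‖ ≤ C) {E₀ : ℝ} (hE : ∀ z, ‖z‖ ≤ E₀ → 0 < ⨅ x, P x z)
    {ι : Type*} [Finite ι] (U : ι → Set (Rd d)) (hU : ∀ i, IsOpen (U i))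
    (hne : ∀ i, (U i).Nonempty) (hsub : ∀ i, ∀ z ∈ U i, ‖z‖ ≤ E₀)
    {b₁ b₂ : ℝ} (hb₁ : 0 < b₁) (hb₂ : 0 < b₂)
    (hnn : ∀ y z, 0 ≤ inner ℝ (Ψ (y + z) + Ψ (y - z)) y)
    (hlow : ∀ y, y ≠ 0 → ∃ i, ∀ z ∈ U i,
      min (b₁ * ‖y‖) (b₂ * ‖y‖ ^ 2) ≤ inner ℝ (Ψ (y + z) + Ψ (y - z)) y) :
    ∃ β₁ β₂ : ℝ, AreDenoisingConstants P Ψ β₁ β₂ := by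
  choose p hp ε hε hvol using fun i => hP.exists_uniform_volume hE (hU i) (hne i) (hsub i)
  -- Any sufficiently small `c` serves all indices at once; this also covers an empty index type,
  -- where there is no minimum to take.
  obtain ⟨c, hc, hc0⟩ : ∃ c : ℝ, (∀ i, 2 * c ≤ p i * ε i) ∧ 0 < c := by
    have h1 : ∀ᶠ c : ℝ in nhdsWithin 0 (Set.Ioi 0), ∀ i, 2 * c ≤ p i * ε i := by
      refine Filter.eventually_all.2 fun i => nhdsWithin_le_nhds ?_
      have : Filter.Tendsto (fun c : ℝ => 2 * c) (nhds 0) (nhds (2 * 0)) :=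
        (continuous_const_mul 2).tendsto 0
      rw [mul_zero] at this
      exact this.eventually_le_const (mul_pos (hp i) (hε i))
    exact (h1.and self_mem_nhdsWithin).exists
  refine ⟨c * b₁, c * b₂, by positivity, by positivity, fun x y => ?_⟩
  rcases eq_or_ne y 0 with rfl | hy
  · simp
  obtain ⟨i, hi⟩ := hlow y hy
  set m := min (b₁ * ‖y‖) (b₂ * ‖y‖ ^ 2) with hmdef
  have hm0 : 0 ≤ m := le_min (by positivity) (by positivity)
  have hmin : min (c * b₁ * ‖y‖) (c * b₂ * ‖y‖ ^ 2) = c * m := by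
    rw [hmdef, mul_min_of_nonneg _ _ hc0.le]; simp only [mul_assoc]
  rw [hmin]
  set S := U i ∩ {z | p i ≤ P x z}
  have hS : MeasurableSet S :=
    (hU i).measurableSet.inter (measurableSet_le measurable_const (hP.measurable_apply x))
  have hSfin : volume S ≠ ⊤ :=
    ((measure_mono fun z hz => mem_closedBall_zero_iff.2 (hsub i z hz.1)).trans_lt
      (measure_closedBall_lt_top (x := (0 : Rd d)) (r := E₀))).ne
  have hint := hP.integrable_symmetrized hm hb x y
  have key : p i * m * volume.real S ≤ ∫ z, P x z * inner ℝ (Ψ (y + z) + Ψ (y - z)) y := by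
    refine le_trans ?_ (setIntegral_le_integral (s := S) hint
      (Filter.Eventually.of_forall fun z => mul_nonneg (hP.nonneg x z) (hnn y z)))
    refine setIntegral_ge_of_const_le_real hS hSfin (fun z hz => ?_) hint.integrableOn
    exact mul_le_mul hz.2 (hi z hz.1) hm0 (hP.nonneg x z)
  rw [← two_mul_inner_denoised hP hm hb] at key
  have h2 : 2 * c * m ≤ p i * m * volume.real S := by
    calc 2 * c * m ≤ p i * ε i * m := mul_le_mul_of_nonneg_right (hc i) hm0
      _ = p i * m * ε i := by ring
      _ ≤ _ := mul_le_mul_of_nonneg_left (hvol i x) (mul_nonneg (hp i).le hm0)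
  linarith

end DensityLemmas

/-! ### Component-wise nonlinearities -/

section Componentwise

variable {ψ : ℝ → ℝ}

/-- Oddness turns the sum into an increment of `ψ` centred at the noise `v`, with half-width `|s|`;
monotonicity then controls its sign and allows the half-width to be shortened. -/
theorem mul_symmetrized_eq_abs (hodd : ∀ s, ψ (-s) = -ψ s) (s v : ℝ) :
    s * (ψ (s + v) + ψ (s - v)) = |s| * (ψ (v + |s|) - ψ (v - |s|)) := by
  rcases abs_cases s with ⟨h, -⟩ | ⟨h, -⟩
  · rw [h, ← neg_sub s v, hodd, add_comm v s]; ring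
  · rw [h, ← sub_eq_add_neg v s, ← neg_sub s v, hodd, sub_neg_eq_add, add_comm v s]
    ring

theorem mul_symmetrized_nonneg (hodd : ∀ s, ψ (-s) = -ψ s) (hmono : Monotone ψ)
    (s v : ℝ) : 0 ≤ s * (ψ (s + v) + ψ (s - v)) := by
  rw [mul_symmetrized_eq_abs hodd]
  have := abs_nonneg s
  exact mul_nonneg this (sub_nonneg.2 (hmono (by linarith)))

/-- Strict monotonicity forces a positive slope somewhere near the origin, though `ψ'` may vanish at
`0` itself. By continuity `ψ'` stays above half that slope near `s₀`, and an increment shortened to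
half-width at most `r` remains there. -/
theorem IsSmoothScalar.exists_increment_bound (hψ : IsSmoothScalar ψ) {E₀ : ℝ} (hE₀ : 0 < E₀) :
    ∃ s₀ > 0, ∃ r > 0, ∃ m > 0, s₀ + r ≤ E₀ ∧ ∀ s v, |v - s₀| < r →
      m * (|s| * min |s| r) ≤ s * (ψ (s + v) + ψ (s - v)) := by
  obtain ⟨c, hc, hsm⟩ := hψ.strictMono
  have hdiff : Differentiable ℝ ψ := hψ.contDiff.differentiable (by norm_num)
  obtain ⟨w, hw, hwc, hwE⟩ : ∃ w > 0, w ≤ c ∧ w ≤ E₀ :=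
    ⟨min c E₀, lt_min hc hE₀, min_le_left _ _, min_le_right _ _⟩
  obtain ⟨s₀, hs₀, hder⟩ := exists_deriv_eq_slope ψ (a := w / 3) (b := 2 * w / 3) (by linarith)
    hdiff.continuous.continuousOn hdiff.differentiableOn
  have hpos : 0 < deriv ψ s₀ := by
    rw [hder]
    refine div_pos (sub_pos.2 (hsm ?_ ?_ ?_)) (by linarith)
    · constructor <;> linarith
    · constructor <;> linarith
    · linarith
  have hcont : Continuous (deriv ψ) := hψ.contDiff.continuous_deriv (by norm_num)
  obtain ⟨ρ, hρ, hball⟩ := Metric.eventually_nhds_iff.1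
    (hcont.continuousAt.eventually (lt_mem_nhds (half_lt_self hpos)))
  have hs0 := hs₀.1
  have hs1 := hs₀.2
  -- With `r ≤ ρ / 2`, the centre and the half-width together move less than `ρ` from `s₀`; `r ≤ w /
  -- 3` keeps `s₀ + r` within `E₀`. Half the slope times the length `2 * h` gives the constant `ψ'
  -- (s₀)`.
  refine ⟨s₀, by linarith, min (ρ / 2) (w / 3), by positivity, deriv ψ s₀, hpos, ?_, ?_⟩
  · have := min_le_right (ρ / 2) (w / 3)
    linarith
  · intro s v hv
    set r := min (ρ / 2) (w / 3)
    have hrρ : r ≤ ρ / 2 := min_le_left _ _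
    set h := min |s| r with hh
    have hr0 : 0 < r := by positivity
    have hh0 : 0 ≤ h := le_min (abs_nonneg s) hr0.le
    have hhr : h ≤ r := min_le_right _ _
    have hhs : h ≤ |s| := min_le_left _ _
    rw [mul_symmetrized_eq_abs hψ.odd]
    rw [abs_lt] at hv
    have hinc := Convex.mul_sub_le_image_sub_of_le_deriv (D := Set.Icc (v - h) (v + h))
      (convex_Icc _ _) hdiff.continuous.continuousOn hdiff.differentiableOn
      (C := deriv ψ s₀ / 2) (fun u hu => by
        rw [interior_Icc] at hu
        refine (hball (?_ : dist u s₀ < ρ)).le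
        rw [Real.dist_eq, abs_lt]
        constructor <;> linarith [hu.1, hu.2])
      (v - h) ⟨le_rfl, by linarith⟩ (v + h) ⟨by linarith, le_rfl⟩ (by linarith)
    have h1 : ψ (v + h) ≤ ψ (v + |s|) := hψ.mono (by linarith)
    have h2 : ψ (v - |s|) ≤ ψ (v - h) := hψ.mono (by linarith)
    have h3 : deriv ψ s₀ * h ≤ ψ (v + |s|) - ψ (v - |s|) := by linarith
    calc deriv ψ s₀ * (|s| * h) = |s| * (deriv ψ s₀ * h) := by ring
      _ ≤ _ := mul_le_mul_of_nonneg_left h3 (abs_nonneg s)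

theorem norm_le_sqrt_mul_of_forall_abs_le {d : ℕ} {y : Rd d} {b : ℝ} (h : ∀ i, |y i| ≤ b) :
    ‖y‖ ≤ Real.sqrt d * b := by
  rcases isEmpty_or_nonempty (Fin d) with hd | ⟨⟨i⟩⟩
  · rw [EuclideanSpace.norm_eq]
    have : d = 0 := by rw [← Fintype.card_fin d]; exact Fintype.card_eq_zero_iff.2 hd
    subst this
    simp
  · have hb : 0 ≤ b := (abs_nonneg _).trans (h i)
    rw [EuclideanSpace.norm_eq]
    calc √(∑ i, ‖y i‖ ^ 2) ≤ √(∑ _i : Fin d, b ^ 2) := by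
          gcongr with i; exact h i
      _ = _ := by simp [Real.sqrt_sq hb]

theorem exists_norm_le_sqrt_mul_abs {d : ℕ} {y : Rd d} (hy : y ≠ 0) :
    ∃ i, ‖y‖ ≤ Real.sqrt d * |y i| := by
  have : Nonempty (Fin d) := by
    by_contra h
    rw [not_nonempty_iff] at h
    exact hy (Subsingleton.elim _ _)
  obtain ⟨i, hi⟩ := Finite.exists_max fun i => |y i|
  exact ⟨i, norm_le_sqrt_mul_of_forall_abs_le hi⟩

/-- Some coordinate has size at least `‖y‖ / √d`. The ball around `s₀` times that basis vector
serves as the test set, and the other coordinates contribute nonnegatively. -/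
theorem exists_areDenoisingConstants_of_componentwise {d : ℕ} {P : Rd d → Rd d → ℝ}
    {Ψ : Rd d → Rd d} (hP : IsSymmetricNoiseDensity P) (hψ : IsSmoothScalar ψ)
    (hΨ : ∀ x i, Ψ x i = ψ (x i)) :
    ∃ β₁ β₂ : ℝ, AreDenoisingConstants P Ψ β₁ β₂ := by
  obtain ⟨E₀, hE₀, hE⟩ := hP.pos
  obtain ⟨s₀, hs₀, r, hr, m, hm, hsr, hinc⟩ := hψ.exists_increment_bound hE₀
  obtain ⟨C₁, hC₁, hbdd⟩ := hψ.bdd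
  have hmeas : Measurable Ψ := by
    have : Ψ = fun x => WithLp.toLp 2 fun i => ψ (x i) := by
      funext x; ext i; exact hΨ x i
    rw [this]
    have hψm := hψ.mono.measurable
    fun_prop
  have hb : ∀ y, ‖Ψ y‖ ≤ Real.sqrt d * C₁ := fun y =>
    norm_le_sqrt_mul_of_forall_abs_le fun i => by rw [hΨ]; exact hbdd _
  have hexp : ∀ y z : Rd d, inner ℝ (Ψ (y + z) + Ψ (y - z)) y =
      ∑ i, y i * (ψ (y i + z i) + ψ (y i - z i)) := by
    intro y z
    simp [PiLp.inner_apply, hΨ]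
  -- The added `1` keeps the denominator positive when `d = 0`.
  let D : ℝ := Real.sqrt d + 1
  have hD : 0 < D := by positivity
  refine exists_areDenoisingConstants_of_open hP hmeas hb hE
    (fun i : Fin d => Metric.ball (EuclideanSpace.single i s₀) r) (fun i => Metric.isOpen_ball)
    (fun i => Metric.nonempty_ball.2 hr) (fun i z hz => ?_)
    (b₁ := m * r / D) (b₂ := m / D ^ 2) (by positivity) (by positivity)
    (fun y z => ?_) (fun y hy => ?_)
  · rw [Metric.mem_ball, dist_eq_norm] at hz
    have h1 : ‖(EuclideanSpace.single i s₀ : Rd d)‖ = s₀ := by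
      simp [abs_of_pos hs₀]
    have h2 := norm_le_norm_add_norm_sub' z (EuclideanSpace.single i s₀ : Rd d)
    linarith
  · rw [hexp]
    exact Finset.sum_nonneg fun i _ => mul_symmetrized_nonneg hψ.odd hψ.mono _ _
  · obtain ⟨i, hi⟩ := exists_norm_le_sqrt_mul_abs hy
    refine ⟨i, fun z hz => ?_⟩
    rw [hexp]
    refine le_trans ?_ (Finset.single_le_sum (f := fun i => y i * (ψ (y i + z i) + ψ (y i - z i)))
      (fun i _ => mul_symmetrized_nonneg hψ.odd hψ.mono _ _) (Finset.mem_univ i))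
    have hzi : |z i - s₀| < r := by
      rw [Metric.mem_ball, dist_eq_norm] at hz
      have := PiLp.norm_apply_le (z - EuclideanSpace.single i s₀) i
      simp only [PiLp.sub_apply, PiLp.single_apply, if_true, Real.norm_eq_abs] at this
      linarith
    refine le_trans ?_ (hinc (y i) (z i) hzi)
    have hyD : ‖y‖ / D ≤ |y i| := by
      rw [div_le_iff₀ hD]
      have := abs_nonneg (y i)
      simp only [D]
      linarith
    have h0 : 0 ≤ ‖y‖ / D := by positivity
    rcases le_total |y i| r with h | h
    · rw [min_eq_left h]
      refine (min_le_right _ _).trans ?_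
      calc m / D ^ 2 * ‖y‖ ^ 2 = m * (‖y‖ / D * (‖y‖ / D)) := by field_simp
        _ ≤ _ := by gcongr
    · rw [min_eq_right h]
      refine (min_le_left _ _).trans ?_
      calc m * r / D * ‖y‖ = m * (‖y‖ / D * r) := by field_simp
        _ ≤ _ := by gcongr

end Componentwise

/-! ### Joint nonlinearities in dimension at least two -/

section Joint

/-- The properties of the scalar map of a joint nonlinearity that matter, with the irrelevant
value at `0` made positive. -/
theorem IsJointScalar.exists_pos_extension {φ : ℝ → ℝ} (hφ : IsJointScalar φ) :
    ∃ φ' : ℝ → ℝ, (∀ s, 0 < s → φ' s = φ s) ∧ (∀ s, 0 < φ' s) ∧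
      AntitoneOn φ' (Set.Ioi 0) ∧ MonotoneOn (fun s => s * φ' s) (Set.Ici 0) ∧
      ∃ C > 0, ∀ s, 0 ≤ s → s * φ' s ≤ C := by
  obtain ⟨C, hC, hbdd⟩ := hφ.bdd
  have heq : ∀ s, 0 < s → (if 0 < s then φ s else 1) = φ s := fun s hs => if_pos hs
  have hpos : ∀ s, 0 < (if 0 < s then φ s else 1) := fun s => by
    split_ifs with h
    · exact hφ.pos s h
    · exact one_pos
  refine ⟨fun s => if 0 < s then φ s else 1, heq, hpos, ?_, ?_, C, hC, ?_⟩
  · intro s hs t ht hst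
    simpa only [heq s hs, heq t ht] using hφ.anti hs ht hst
  · intro s hs t ht hst
    rcases eq_or_lt_of_le (Set.mem_Ici.1 hs) with rfl | hs'
    · simpa only [zero_mul] using mul_nonneg ht (hpos t).le
    · have ht' := hs'.trans_le hst
      simpa only [heq s hs', heq t ht'] using hφ.mono hs' ht' hst
  · intro s hs
    rcases eq_or_lt_of_le hs with rfl | hs'
    · simpa using hC.le
    · simpa only [heq s hs'] using hbdd s hs'

variable {E : Type*} [NormedAddCommGroup E] [InnerProductSpace ℝ E] {φ : ℝ → ℝ}

/-- The first term is nonnegative when `s * φ s` is monotone. The second is a weight times a defect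
that measures how far `y` and `z` are from being parallel. -/
theorem two_mul_inner_radial (φ : ℝ → ℝ) (y z : E) :
    2 * inner ℝ (φ ‖y + z‖ • (y + z) + φ ‖y - z‖ • (y - z)) y =
      (‖y + z‖ * φ ‖y + z‖ - ‖y - z‖ * φ ‖y - z‖) * (‖y + z‖ - ‖y - z‖) +
        (φ ‖y + z‖ + φ ‖y - z‖) * (‖y + z‖ * ‖y - z‖ + (‖y‖ ^ 2 - ‖z‖ ^ 2)) := by
  have h1 : ‖y + z‖ ^ 2 = ‖y‖ ^ 2 + 2 * inner ℝ y z + ‖z‖ ^ 2 := norm_add_sq_real y z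
  have h2 : ‖y - z‖ ^ 2 = ‖y‖ ^ 2 - 2 * inner ℝ y z + ‖z‖ ^ 2 := norm_sub_sq_real y z
  rw [inner_add_left, real_inner_smul_left, real_inner_smul_left, inner_add_left, inner_sub_left,
    real_inner_self_eq_norm_sq, real_inner_comm y z]
  linear_combination (-φ ‖y + z‖) * h1 - φ ‖y - z‖ * h2

/-- Cauchy–Schwarz for `y + z` and `y - z`, whose inner product is `‖y‖ ^ 2 - ‖z‖ ^ 2`. -/
theorem norm_sq_sub_le_norm_mul_norm (y z : E) :
    0 ≤ ‖y + z‖ * ‖y - z‖ + (‖y‖ ^ 2 - ‖z‖ ^ 2) := by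
  have h1 : ‖y + z‖ ^ 2 = ‖y‖ ^ 2 + 2 * inner ℝ y z + ‖z‖ ^ 2 := norm_add_sq_real y z
  have h2 : ‖y - z‖ ^ 2 = ‖y‖ ^ 2 - 2 * inner ℝ y z + ‖z‖ ^ 2 := norm_sub_sq_real y z
  have h3 : inner ℝ (y + z) (y - z) = ‖y‖ ^ 2 - ‖z‖ ^ 2 := by
    rw [inner_add_left, inner_sub_right, inner_sub_right, real_inner_self_eq_norm_sq,
      real_inner_self_eq_norm_sq, real_inner_comm y z]
    ring
  have h4 := neg_le_of_abs_le (abs_real_inner_le_norm (y + z) (y - z))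
  linarith

theorem monotoneOn_mul_sub_nonneg {g : ℝ → ℝ} (hg : MonotoneOn g (Set.Ici 0)) {s t : ℝ}
    (hs : 0 ≤ s) (ht : 0 ≤ t) : 0 ≤ (g s - g t) * (s - t) := by
  rcases le_total s t with h | h
  · exact mul_nonneg_of_nonpos_of_nonpos (sub_nonpos.2 (hg hs ht h)) (sub_nonpos.2 h)
  · exact mul_nonneg (sub_nonneg.2 (hg ht hs h)) (sub_nonneg.2 h)

theorem inner_radial_nonneg (hpos : ∀ s, 0 < φ s)
    (hmono : MonotoneOn (fun s => s * φ s) (Set.Ici 0)) (y z : E) :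
    0 ≤ inner ℝ (φ ‖y + z‖ • (y + z) + φ ‖y - z‖ • (y - z)) y := by
  have h1 := two_mul_inner_radial φ y z
  have h2 := monotoneOn_mul_sub_nonneg hmono (norm_nonneg (y + z)) (norm_nonneg (y - z))
  have h3 := mul_nonneg (add_pos (hpos ‖y + z‖) (hpos ‖y - z‖)).le
    (norm_sq_sub_le_norm_mul_norm y z)
  linarith

/-- Lower bound when `y` and `z` are quantitatively not parallel. -/
theorem le_inner_radial (hpos : ∀ s, 0 < φ s)
    (hanti : AntitoneOn φ (Set.Ioi 0)) (hmono : MonotoneOn (fun s => s * φ s) (Set.Ici 0))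
    {y z : E} (hy : y ≠ 0) (hz : z ≠ 0) {κ : ℝ} (hκ : 0 < κ)
    (h : (inner ℝ y z) ^ 2 ≤ (1 - κ) * (‖y‖ ^ 2 * ‖z‖ ^ 2)) :
    2 * κ * (φ (‖y‖ + ‖z‖) * ‖y‖ ^ 2) ≤
      inner ℝ (φ ‖y + z‖ • (y + z) + φ ‖y - z‖ • (y - z)) y := by
  have h1 : ‖y + z‖ ^ 2 = ‖y‖ ^ 2 + 2 * inner ℝ y z + ‖z‖ ^ 2 := norm_add_sq_real y z
  have h2 : ‖y - z‖ ^ 2 = ‖y‖ ^ 2 - 2 * inner ℝ y z + ‖z‖ ^ 2 := norm_sub_sq_real y z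
  have hy0 : 0 < ‖y‖ := norm_pos_iff.2 hy
  have hz0 : 0 < ‖z‖ := norm_pos_iff.2 hz
  set J := ‖y + z‖ * ‖y - z‖ + (‖y‖ ^ 2 - ‖z‖ ^ 2) with hJ
  have hJ0 : 0 ≤ J := norm_sq_sub_le_norm_mul_norm y z
  have hden : ‖y + z‖ * ‖y - z‖ - (‖y‖ ^ 2 - ‖z‖ ^ 2) ≤ 2 * ‖z‖ ^ 2 := by
    nlinarith [sq_nonneg (‖y + z‖ - ‖y - z‖)]
  -- The defect times its conjugate is four times the Gram determinant of `y` and `z`. As the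
  -- conjugate is at most `2 * ‖z‖ ^ 2`, the angle condition bounds `J` below.
  have hprod : J * (‖y + z‖ * ‖y - z‖ - (‖y‖ ^ 2 - ‖z‖ ^ 2)) =
      4 * (‖y‖ ^ 2 * ‖z‖ ^ 2 - (inner ℝ y z) ^ 2) := by
    have : J * (‖y + z‖ * ‖y - z‖ - (‖y‖ ^ 2 - ‖z‖ ^ 2)) =
        ‖y + z‖ ^ 2 * ‖y - z‖ ^ 2 - (‖y‖ ^ 2 - ‖z‖ ^ 2) ^ 2 := by rw [hJ]; ring
    rw [this, h1, h2]; ring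
  have hJlow : 2 * κ * ‖y‖ ^ 2 ≤ J := by
    have h3 := mul_le_mul_of_nonneg_left hden hJ0
    have h4 : 2 * κ * ‖y‖ ^ 2 * ‖z‖ ^ 2 ≤ J * ‖z‖ ^ 2 := by linarith
    exact le_of_mul_le_mul_right h4 (by positivity)
  have hJpos : 0 < J := lt_of_lt_of_le (by positivity) hJlow
  -- Monotonicity of `φ` is available only on positive arguments, so `y = ±z` must be excluded;
  -- there `J` would vanish.
  have hu : 0 < ‖y + z‖ := by
    rw [norm_pos_iff]
    intro h0
    have : z = -y := (neg_eq_of_add_eq_zero_right h0).symm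
    rw [hJ, h0, this] at hJpos
    simp at hJpos
  have hv : 0 < ‖y - z‖ := by
    rw [norm_pos_iff]
    intro h0
    rw [hJ, h0, sub_eq_zero.1 h0] at hJpos
    simp at hJpos
  have hs : 0 < ‖y‖ + ‖z‖ := by positivity
  have h5 := hanti hu hs (norm_add_le y z)
  have h6 := hanti hv hs (norm_sub_le y z)
  have h7 := two_mul_inner_radial φ y z
  have h8 := monotoneOn_mul_sub_nonneg hmono (norm_nonneg (y + z)) (norm_nonneg (y - z))
  have h9 : 2 * φ (‖y‖ + ‖z‖) * (2 * κ * ‖y‖ ^ 2) ≤ (φ ‖y + z‖ + φ ‖y - z‖) * J :=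
    mul_le_mul (by linarith) hJlow (by positivity)
      (add_pos (hpos ‖y + z‖) (hpos ‖y - z‖)).le
  linarith

/-- For small `s` the argument `s + v` is at most `4 * r`. For large `s` it is at most `2 * s`, and
`φ` decays no faster than `1 / s` because `s * φ s` is non-decreasing. -/
theorem min_le_radial_mul_sq (hanti : AntitoneOn φ (Set.Ioi 0))
    (hmono : MonotoneOn (fun s => s * φ s) (Set.Ici 0)) {s v r : ℝ} (hs : 0 < s) (hv : 0 ≤ v)
    (hr : 0 < r) (hvr : v ≤ 2 * r) :
    min (2 * r * φ (4 * r) * s) (φ (4 * r) * s ^ 2) ≤ φ (s + v) * s ^ 2 := by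
  rcases le_total s (2 * r) with h | h
  · refine (min_le_right _ _).trans (mul_le_mul_of_nonneg_right ?_ (sq_nonneg s))
    exact hanti (Set.mem_Ioi.2 (by linarith)) (Set.mem_Ioi.2 (by linarith)) (by linarith)
  · refine (min_le_left _ _).trans ?_
    have h1 : φ (2 * s) ≤ φ (s + v) :=
      hanti (Set.mem_Ioi.2 (by linarith)) (Set.mem_Ioi.2 (by linarith)) (by linarith)
    have h2 : 4 * r * φ (4 * r) ≤ 2 * s * φ (2 * s) :=
      hmono (Set.mem_Ici.2 (by linarith)) (Set.mem_Ici.2 (by linarith)) (by linarith)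
    nlinarith [mul_le_mul_of_nonneg_right h2 hs.le,
      mul_le_mul_of_nonneg_right h1 (sq_nonneg s)]

variable {d : ℕ} {P : Rd d → Rd d → ℝ} {Ψ : Rd d → Rd d}

/-- The map is the unit vector times `s * φ s` at `s = ‖x‖`, and a monotone function is Borel. -/
theorem measurable_radial (hmono : MonotoneOn (fun s => s * φ s) (Set.Ici 0)) :
    Measurable fun x : Rd d => φ ‖x‖ • x := by
  have hg : Monotone fun s : ℝ => max s 0 * φ (max s 0) := fun s t hst =>
    hmono (le_max_right s 0) (le_max_right t 0) (max_le_max hst le_rfl)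
  have heq : (fun x : Rd d => φ ‖x‖ • x) =
      fun x => (max ‖x‖ 0 * φ (max ‖x‖ 0)) • (‖x‖⁻¹ • x) := by
    funext x
    rcases eq_or_ne x 0 with rfl | hx
    · simp
    · rw [max_eq_left (norm_nonneg x), smul_smul]
      congr 1
      have := norm_ne_zero_iff.2 hx
      field_simp
  rw [heq]
  exact (hg.measurable.comp measurable_norm).smul (by fun_prop)

theorem norm_radial_le {C : ℝ} (hpos : ∀ s, 0 < φ s) (hbdd : ∀ s, 0 ≤ s → s * φ s ≤ C) (x : E) :
    ‖φ ‖x‖ • x‖ ≤ C := by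
  rw [norm_smul, Real.norm_of_nonneg (hpos _).le, mul_comm]
  exact hbdd _ (norm_nonneg x)

/-- Two coordinates cannot both carry more than half of `‖y‖ ^ 2`, so a small ball around a multiple
of some basis vector stays away from the line through `y`. -/
theorem exists_areDenoisingConstants_of_radial_of_two_le (hP : IsSymmetricNoiseDensity P)
    (hd : 2 ≤ d) (hpos : ∀ s, 0 < φ s) (hanti : AntitoneOn φ (Set.Ioi 0))
    (hmono : MonotoneOn (fun s => s * φ s) (Set.Ici 0)) {C : ℝ}
    (hbdd : ∀ s, 0 ≤ s → s * φ s ≤ C) (hΨ : ∀ x, Ψ x = φ ‖x‖ • x) :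
    ∃ β₁ β₂ : ℝ, AreDenoisingConstants P Ψ β₁ β₂ := by
  obtain rfl : Ψ = fun x => φ ‖x‖ • x := funext hΨ
  obtain ⟨E₀, hE₀, hE⟩ := hP.pos
  obtain ⟨r, hr, hrE⟩ : ∃ r > 0, 2 * r = E₀ := ⟨E₀ / 2, by positivity, by ring⟩
  have hsingle : ∀ i : Fin d, ‖(EuclideanSpace.single i r : Rd d)‖ = r := fun i => by
    simp [abs_of_pos hr]
  have hnear : ∀ (i : Fin d) z, z ∈ Metric.ball (EuclideanSpace.single i r : Rd d) (r / 16) →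
      15 / 16 * r ≤ ‖z‖ ∧ ‖z‖ ≤ 2 * r := by
    intro i z hz
    rw [Metric.mem_ball, dist_eq_norm] at hz
    have h1 := abs_le.1 (abs_norm_sub_norm_le z (EuclideanSpace.single i r : Rd d))
    rw [hsingle] at h1
    constructor <;> linarith [h1.1, h1.2]
  refine exists_areDenoisingConstants_of_open hP (measurable_radial hmono)
    (norm_radial_le hpos hbdd) hE
    (fun i : Fin d => Metric.ball (EuclideanSpace.single i r : Rd d) (r / 16))
    (fun i => Metric.isOpen_ball) (fun i => Metric.nonempty_ball.2 (by positivity))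
    (fun i z hz => hrE ▸ (hnear i z hz).2)
    (b₁ := 2 / 5 * (2 * r * φ (4 * r))) (b₂ := 2 / 5 * φ (4 * r))
    (by have := hpos (4 * r); positivity) (by have := hpos (4 * r); positivity)
    (fun y z => inner_radial_nonneg hpos hmono y z) (fun y hy => ?_)
  have hy0 : 0 < ‖y‖ := norm_pos_iff.2 hy
  obtain ⟨i, hi⟩ : ∃ i : Fin d, 2 * y i ^ 2 ≤ ‖y‖ ^ 2 := by
    by_contra! hcon
    have h1 : ‖y‖ ^ 2 = ∑ i, y i ^ 2 := EuclideanSpace.real_norm_sq_eq y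
    let i0 : Fin d := ⟨0, by omega⟩
    let i1 : Fin d := ⟨1, by omega⟩
    have h01 : i0 ≠ i1 := by simp [i0, i1]
    have h2 : y i0 ^ 2 + y i1 ^ 2 ≤ ∑ i, y i ^ 2 := by
      rw [← Finset.sum_pair (f := fun i => y i ^ 2) h01]
      exact Finset.sum_le_univ_sum_of_nonneg fun i => sq_nonneg _
    linarith [hcon i0, hcon i1]
  refine ⟨i, fun z hz => ?_⟩
  obtain ⟨hz1, hz2⟩ := hnear i z hz
  have hz0 : 0 < ‖z‖ := by linarith [hz1]
  -- Here `3/4` exceeds `1/√2`. Adding the radius `1/16` and dividing by `15/16` gives cosine at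
  -- most `13/15`, whose square is below `4/5`; hence `κ = 1/5`.
  have hyi : |y i| ≤ 3 / 4 * ‖y‖ := by
    refine abs_le_of_sq_le_sq ?_ (by positivity)
    nlinarith
  have hin : |inner ℝ y z| ≤ 13 / 15 * (‖y‖ * ‖z‖) := by
    have h1 : inner ℝ y z = r * y i + inner ℝ y (z - EuclideanSpace.single i r) := by
      rw [inner_sub_right, EuclideanSpace.inner_single_right]
      simp
    rw [Metric.mem_ball, dist_eq_norm] at hz
    have h2 := abs_real_inner_le_norm y (z - EuclideanSpace.single i r)
    have h3 : ‖y‖ * ‖z - EuclideanSpace.single i r‖ ≤ ‖y‖ * (r / 16) := by gcongr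
    have h4 := abs_add_le (r * y i) (inner ℝ y (z - EuclideanSpace.single i r))
    rw [abs_mul, abs_of_pos hr] at h4
    have h5 : r * |y i| ≤ r * (3 / 4 * ‖y‖) := by gcongr
    have h6 : ‖y‖ * (15 / 16 * r) ≤ ‖y‖ * ‖z‖ := by gcongr
    rw [h1]
    linarith
  have hsq : (inner ℝ y z) ^ 2 ≤ (1 - 1 / 5) * (‖y‖ ^ 2 * ‖z‖ ^ 2) := by
    have h1 := sq_le_sq' (by linarith [abs_nonneg (inner ℝ y z)]) hin
    rw [sq_abs] at h1
    have h2 : 0 ≤ ‖y‖ ^ 2 * ‖z‖ ^ 2 := by positivity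
    nlinarith
  refine le_trans ?_ (le_inner_radial hpos hanti hmono hy (norm_pos_iff.1 hz0) (by norm_num) hsq)
  have := min_le_radial_mul_sq hanti hmono hy0 (norm_nonneg z) hr hz2
  calc min (2 / 5 * (2 * r * φ (4 * r)) * ‖y‖) (2 / 5 * φ (4 * r) * ‖y‖ ^ 2)
      = 2 / 5 * min (2 * r * φ (4 * r) * ‖y‖) (φ (4 * r) * ‖y‖ ^ 2) := by
        rw [mul_min_of_nonneg _ _ (by norm_num)]; simp only [mul_assoc]
    _ ≤ 2 / 5 * (φ (‖y‖ + ‖z‖) * ‖y‖ ^ 2) := by gcongr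
    _ = _ := by ring

end Joint

/-! ### Joint nonlinearities on the line -/

section OneDimensional

variable {g : ℝ → ℝ}

/-- A centred increment of a non-decreasing odd function, averaged over a symmetric interval. -/
theorem le_integral_symmetrized (hmono : Monotone g) (hodd : ∀ s, g (-s) = -g s) {E₀ : ℝ}
    (hE₀ : 0 < E₀) (s : ℝ) :
    4 * g (E₀ / 2) * (|s| * min |s| (E₀ / 2)) ≤
      ∫ v in -E₀..E₀, s * (g (s + v) + g (s - v)) := by
  set h := min |s| (E₀ / 2) with hh
  have hh0 : 0 ≤ h := le_min (abs_nonneg s) (by positivity)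
  have hhs : h ≤ |s| := min_le_left _ _
  have hhE : h ≤ E₀ / 2 := min_le_right _ _
  have hint : ∀ a b, IntervalIntegrable g volume a b := fun a b => hmono.intervalIntegrable
  have hadd : ∀ c, Monotone fun v => g (v + c) := fun c a b hab => hmono (by linarith)
  have hsub : ∀ c, Monotone fun v => g (v - c) := fun c a b hab => hmono (by linarith)
  simp only [mul_symmetrized_eq_abs hodd]
  rw [intervalIntegral.integral_const_mul]
  have h1 : (∫ v in -E₀..E₀, (g (v + h) - g (v - h))) ≤
      ∫ v in -E₀..E₀, (g (v + |s|) - g (v - |s|)) :=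
    intervalIntegral.integral_mono_on (by linarith)
      ((hadd h).intervalIntegrable.sub (hsub h).intervalIntegrable)
      ((hadd |s|).intervalIntegrable.sub (hsub |s|).intervalIntegrable)
      fun v _ => sub_le_sub (hmono (by linarith)) (hmono (by linarith))
  -- After shifting, the common part of the two integrals cancels. Only windows of width `2 * h`
  -- around `±E₀` remain, where `h ≤ E₀ / 2` keeps `g` beyond `±g (E₀ / 2)`.
  rw [intervalIntegral.integral_sub (hadd h).intervalIntegrable (hsub h).intervalIntegrable,
    intervalIntegral.integral_comp_add_right, intervalIntegral.integral_comp_sub_right,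
    intervalIntegral.integral_interval_sub_interval_comm' (hint _ _) (hint _ _) (hint _ _)] at h1
  have h2 : (E₀ + h - (E₀ - h)) * g (E₀ / 2) ≤ ∫ v in (E₀ - h)..(E₀ + h), g v := by
    have := intervalIntegral.integral_mono_on (a := E₀ - h) (b := E₀ + h)
      (f := fun _ => g (E₀ / 2)) (by linarith) intervalIntegrable_const (hint _ _)
      fun v hv => hmono (by linarith [hv.1])
    simpa using this
  have h3 : (∫ v in (-E₀ - h)..(-E₀ + h), g v) ≤ (-E₀ + h - (-E₀ - h)) * -g (E₀ / 2) := by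
    have := intervalIntegral.integral_mono_on (a := -E₀ - h) (b := -E₀ + h)
      (g := fun _ => -g (E₀ / 2)) (by linarith) (hint _ _) intervalIntegrable_const
      fun v hv => (hodd (E₀ / 2) ▸ hmono (by linarith [hv.2]))
    simpa using this
  have h4 : 4 * g (E₀ / 2) * h ≤ ∫ v in -E₀..E₀, (g (v + |s|) - g (v - |s|)) := by
    linarith
  calc 4 * g (E₀ / 2) * (|s| * h) = |s| * (4 * g (E₀ / 2) * h) := by ring
    _ ≤ _ := mul_le_mul_of_nonneg_left h4 (abs_nonneg s)

theorem norm_eq_abs_of_fin_one (x : Rd 1) : ‖x‖ = |x 0| := by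
  rw [EuclideanSpace.norm_eq]
  simp [Real.sqrt_sq_eq_abs]

theorem measurePreserving_apply_zero : MeasurePreserving fun z : Rd 1 => z 0 :=
  (volume_preserving_funUnique (Fin 1) ℝ).comp
    (EuclideanSpace.volume_preserving_symm_measurableEquiv_toLp (Fin 1))

/-- On the line `y` and `z` are always parallel. For the sign map the symmetrization vanishes once
`|z| > |y|`, so the useful noise shrinks to the origin with `y`; a uniform lower bound on the
density reduces the claim to a Lebesgue average. -/
theorem exists_areDenoisingConstants_of_radial_of_one {P : Rd 1 → Rd 1 → ℝ} {Ψ : Rd 1 → Rd 1}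
    {φ : ℝ → ℝ} (hP : IsSymmetricNoiseDensity P)
    (hlow : ∃ E₀ > 0, ∃ p > 0, ∀ x z, ‖z‖ ≤ E₀ → p ≤ P x z)
    (hpos : ∀ s, 0 < φ s)
    (hmono : MonotoneOn (fun s => s * φ s) (Set.Ici 0)) {C : ℝ}
    (hbdd : ∀ s, 0 ≤ s → s * φ s ≤ C) (hΨ : ∀ x, Ψ x = φ ‖x‖ • x) :
    ∃ β₁ β₂ : ℝ, AreDenoisingConstants P Ψ β₁ β₂ := by
  obtain rfl : Ψ = fun x => φ ‖x‖ • x := funext hΨ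
  obtain ⟨E₀, hE₀, p, hp, hpP⟩ := hlow
  let g : ℝ → ℝ := fun s => s * φ |s|
  have hodd : ∀ s, g (-s) = -g s := fun s => by simp [g]
  have hgmono : Monotone g := by
    refine monotone_of_odd_of_monotoneOn_nonneg hodd fun s hs t ht hst => ?_
    simpa only [g, abs_of_nonneg (Set.mem_Ici.1 hs), abs_of_nonneg (Set.mem_Ici.1 ht)]
      using hmono hs ht hst
  have hexp : ∀ y z : Rd 1,
      inner ℝ (φ ‖y + z‖ • (y + z) + φ ‖y - z‖ • (y - z)) y =
        y 0 * (g (y 0 + z 0) + g (y 0 - z 0)) := by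
    intro y z
    simp [PiLp.inner_apply, norm_eq_abs_of_fin_one, g]
    left
    ring
  have hm := measurable_radial (d := 1) hmono
  have hb := norm_radial_le (E := Rd 1) hpos hbdd
  have hg2 : 0 < g (E₀ / 2) := mul_pos (by positivity) (hpos _)
  set k := 2 * p * g (E₀ / 2) with hk
  refine ⟨k * (E₀ / 2), k, by positivity, by positivity, fun x y => ?_⟩
  have hint := hP.integrable_symmetrized hm hb x y
  have h2 := two_mul_inner_denoised hP hm hb x y
  set B : Set (Rd 1) := (fun z => z 0) ⁻¹' Set.Ioc (-E₀) E₀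
  have hB : MeasurableSet B := measurePreserving_apply_zero.measurable measurableSet_Ioc
  have hgm := hgmono.measurable
  have hfm : Measurable fun v => y 0 * (g (y 0 + v) + g (y 0 - v)) := by fun_prop
  have hBint : IntegrableOn (fun z : Rd 1 => y 0 * (g (y 0 + z 0) + g (y 0 - z 0))) B := by
    refine Measure.integrableOn_of_bounded (M := (C + C) * ‖y‖) ?_
      (hfm.comp measurePreserving_apply_zero.measurable).aestronglyMeasurable
      (Filter.Eventually.of_forall fun z => hexp y z ▸ inner_symmetrized_bdd hb y z)
    rw [measurePreserving_apply_zero.measure_preimage measurableSet_Ioc.nullMeasurableSet]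
    exact measure_Ioc_lt_top.ne
  have h3 : p * (4 * g (E₀ / 2) * (|y 0| * min |y 0| (E₀ / 2))) ≤
      ∫ z, P x z * inner ℝ (φ ‖y + z‖ • (y + z) + φ ‖y - z‖ • (y - z)) y := by
    calc _ ≤ p * ∫ v in -E₀..E₀, y 0 * (g (y 0 + v) + g (y 0 - v)) :=
          mul_le_mul_of_nonneg_left (le_integral_symmetrized hgmono hodd hE₀ (y 0)) hp.le
      _ = p * ∫ z in B, y 0 * (g (y 0 + z 0) + g (y 0 - z 0)) := by
          rw [intervalIntegral.integral_of_le (by linarith),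
            ← measurePreserving_apply_zero.map_eq,
            setIntegral_map measurableSet_Ioc hfm.aestronglyMeasurable
              measurePreserving_apply_zero.measurable.aemeasurable]
      _ = ∫ z in B, p * (y 0 * (g (y 0 + z 0) + g (y 0 - z 0))) := (integral_const_mul _ _).symm
      _ ≤ ∫ z in B, P x z * inner ℝ (φ ‖y + z‖ • (y + z) + φ ‖y - z‖ • (y - z)) y := by
          refine setIntegral_mono_on (hBint.const_mul p) hint.integrableOn hB fun z hz => ?_
          rw [hexp]
          refine mul_le_mul_of_nonneg_right (hpP x z ?_)
            (mul_symmetrized_nonneg hodd hgmono _ _)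
          rw [norm_eq_abs_of_fin_one, abs_le]
          exact ⟨hz.1.le, hz.2⟩
      _ ≤ _ := setIntegral_le_integral hint (Filter.Eventually.of_forall fun z =>
          mul_nonneg (hP.nonneg x z) (inner_radial_nonneg hpos hmono y z))
  rw [← h2, ← norm_eq_abs_of_fin_one] at h3
  have h4 : min (k * (E₀ / 2) * ‖y‖) (k * ‖y‖ ^ 2) = k * (‖y‖ * min ‖y‖ (E₀ / 2)) := by
    rw [mul_min_of_nonneg _ _ (norm_nonneg y), mul_min_of_nonneg _ _ (by positivity : 0 ≤ k),
      min_comm]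
    ring_nf
  rw [h4, hk]
  linarith

end OneDimensional

/-- Denoising constants exist for both kinds of nonlinearities. -/
theorem exists_areDenoisingConstants {d : ℕ} (Ψ : Rd d → Rd d)
    (hΨ : IsSmoothComponentwise Ψ ∨ IsJoint Ψ)
    (P : Rd d → Rd d → ℝ) (hP : IsSymmetricNoiseDensity P)
    (hone : d = 1 → ¬ IsSmoothComponentwise Ψ →
      ∃ E₀ > 0, ∃ p > 0, ∀ x z, ‖z‖ ≤ E₀ → p ≤ P x z) :
    ∃ β₁ β₂ : ℝ, AreDenoisingConstants P Ψ β₁ β₂ := by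
  -- A map may be of both kinds; the extra one-dimensional assumption is available only for those
  -- not component-wise.
  by_cases hc : IsSmoothComponentwise Ψ
  · obtain ⟨ψ, hψ, h⟩ := hc
    exact exists_areDenoisingConstants_of_componentwise hP hψ h
  obtain ⟨φ, hφ, hΨφ⟩ := hΨ.resolve_left hc
  obtain ⟨φ', heq, hpos, hanti, hmono, C, -, hbdd⟩ := hφ.exists_pos_extension
  have h : ∀ x, Ψ x = φ' ‖x‖ • x := fun x => by
    rcases eq_or_ne x 0 with rfl | hx
    · simp [hΨφ]
    · rw [hΨφ, heq _ (norm_pos_iff.2 hx)]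
  rcases Nat.lt_or_ge d 2 with hd | hd
  · interval_cases d
    · refine ⟨1, 1, one_pos, one_pos, fun x y => ?_⟩
      simp [Subsingleton.elim y 0]
    · exact exists_areDenoisingConstants_of_radial_of_one hP (hone rfl hc) hpos hmono hbdd h
  · exact exists_areDenoisingConstants_of_radial_of_two_le hP hd hpos hanti hmono hbdd h

theorem measurable_of_componentwise_or_joint {d : ℕ} {Ψ : Rd d → Rd d}
    (hΨ : IsSmoothComponentwise Ψ ∨ IsJoint Ψ) : Measurable Ψ := by
  rcases hΨ with ⟨ψ, hψ, h⟩ | ⟨φ, hφ, h⟩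
  · have : Ψ = fun x => WithLp.toLp 2 fun i => ψ (x i) := by
      funext x; ext i; exact h x i
    rw [this]
    have hψm := hψ.mono.measurable
    fun_prop
  · obtain ⟨φ', heq, -, -, hmono, -⟩ := hφ.exists_pos_extension
    have : Ψ = fun x => φ' ‖x‖ • x := by
      funext x
      rcases eq_or_ne x 0 with rfl | hx
      · simp [h]
      · rw [h, heq _ (norm_pos_iff.2 hx)]
    rw [this]
    exact measurable_radial hmono

/-! ### The noise kernel and Hoeffding's bound -/

section NoiseKernel

open ProbabilityTheory

variable {d : ℕ} {P : Rd d → Rd d → ℝ} {Ψ : Rd d → Rd d}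

/-- The Markov kernel with densities `P x`. -/
noncomputable def noiseKernel (P : Rd d → Rd d → ℝ) : Kernel (Rd d) (Rd d) :=
  Kernel.withDensity (Kernel.const _ volume) fun x z => ENNReal.ofReal (P x z)

theorem noiseKernel_apply (hP : IsSymmetricNoiseDensity P) (x : Rd d) :
    noiseKernel P x = volume.withDensity fun z => ENNReal.ofReal (P x z) := by
  rw [noiseKernel, Kernel.withDensity_apply _ hP.measurable.ennreal_ofReal, Kernel.const_apply]

theorem noiseKernel_apply_set (hP : IsSymmetricNoiseDensity P) (x : Rd d) {B : Set (Rd d)}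
    (hB : MeasurableSet B) : noiseKernel P x B = ENNReal.ofReal (∫ z in B, P x z) := by
  rw [noiseKernel_apply hP, withDensity_apply _ hB,
    ofReal_integral_eq_lintegral_ofReal (hP.integrable x).integrableOn
      (Filter.Eventually.of_forall (hP.nonneg x))]

theorem isMarkovKernel_noiseKernel (hP : IsSymmetricNoiseDensity P) :
    IsMarkovKernel (noiseKernel P) :=
  ⟨fun x => ⟨by
    rw [noiseKernel_apply_set hP x MeasurableSet.univ, Measure.restrict_univ,
      hP.integral_eq_one, ENNReal.ofReal_one]⟩⟩

theorem integral_noiseKernel {E : Type*} [NormedAddCommGroup E] [NormedSpace ℝ E]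
    (hP : IsSymmetricNoiseDensity P) (x : Rd d) (h : Rd d → E) :
    ∫ z, h z ∂noiseKernel P x = ∫ z, P x z • h z := by
  rw [noiseKernel_apply hP, integral_withDensity_eq_integral_toReal_smul
    (hP.measurable_apply x).ennreal_ofReal
    (Filter.Eventually.of_forall fun _ => ENNReal.ofReal_lt_top)]
  simp only [ENNReal.toReal_ofReal (hP.nonneg _ _)]

/-- Hoeffding's bound for one step of the nonlinear method. -/
theorem lintegral_exp_noiseKernel_le (hP : IsSymmetricNoiseDensity P) (hm : Measurable Ψ) {C : ℝ}
    (hb : ∀ y, ‖Ψ y‖ ≤ C) {α : ℝ} (hα : 0 ≤ α) (x y : Rd d) :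
    ∫⁻ z, ENNReal.ofReal (Real.exp (-α * inner ℝ (Ψ (y + z)) y)) ∂noiseKernel P x ≤
      ENNReal.ofReal (Real.exp (-α * inner ℝ (denoised P Ψ x y) y + (α * C * ‖y‖) ^ 2 / 2)) := by
  have := isMarkovKernel_noiseKernel hP
  have hC : 0 ≤ C := (norm_nonneg _).trans (hb 0)
  set X : Rd d → ℝ := fun z => -α * inner ℝ (Ψ (y + z)) y with hX
  have hXm : Measurable X := by fun_prop
  set M := α * C * ‖y‖ with hM
  have hM0 : 0 ≤ M := by positivity
  have hXb : ∀ z, |X z| ≤ M := fun z => by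
    rw [hX]
    simp only [abs_mul, abs_neg, abs_of_nonneg hα]
    rw [hM, mul_assoc]
    exact mul_le_mul_of_nonneg_left ((abs_real_inner_le_norm _ _).trans
      (mul_le_mul_of_nonneg_right (hb _) (norm_nonneg y))) hα
  have hmean : ∫ z, X z ∂noiseKernel P x = -α * inner ℝ (denoised P Ψ x y) y := by
    have h1 : Integrable fun z => P x z • Ψ (y + z) :=
      hP.integrable_smul x (hm.comp (measurable_const_add y)).aestronglyMeasurable fun z => hb _
    rw [hX, integral_const_mul, integral_noiseKernel hP, real_inner_comm, denoised,
      ← integral_inner h1]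
    simp only [real_inner_smul_right, real_inner_comm, smul_eq_mul]
  have hsub := hasSubgaussianMGF_of_mem_Icc (μ := noiseKernel P x) hXm.aemeasurable
    (Filter.Eventually.of_forall fun z => abs_le.1 (hXb z))
  have hmgf := hsub.mgf_le 1
  rw [mgf, hmean] at hmgf
  -- A variable with values in `[-M, M]` has variance proxy equal to the square of half the
  -- interval's length.
  have hpar : (((‖M - -M‖₊ / 2) ^ 2 : NNReal) : ℝ) = M ^ 2 := by
    push_cast
    rw [Real.norm_of_nonneg (by linarith)]
    ring
  rw [hpar] at hmgf
  change ∫⁻ z, ENNReal.ofReal (Real.exp (X z)) ∂noiseKernel P x ≤ _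
  rw [← ofReal_integral_eq_lintegral_ofReal]
  · refine ENNReal.ofReal_le_ofReal ?_
    have hfac : ∀ z, Real.exp (X z) = Real.exp (-α * inner ℝ (denoised P Ψ x y) y) *
        Real.exp (1 * (X z - -α * inner ℝ (denoised P Ψ x y) y)) := fun z => by
      rw [← Real.exp_add]; congr 1; ring
    simp only [hfac]
    rw [integral_const_mul, Real.exp_add]
    refine mul_le_mul_of_nonneg_left (hmgf.trans_eq ?_) (Real.exp_nonneg _)
    congr 1; ring
  · exact Integrable.of_bound hXm.exp.aestronglyMeasurable (Real.exp M)
      (Filter.Eventually.of_forall fun z => by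
        rw [Real.norm_of_nonneg (Real.exp_nonneg _)]
        exact Real.exp_le_exp.2 (abs_le.1 (hXb z)).2)
  · exact Filter.Eventually.of_forall fun z => Real.exp_nonneg _

end NoiseKernel

/-! ### Measurability with respect to the past -/

section History

variable {d : ℕ} {Ω : Type*} {x : ℕ → Ω → Rd d} {α : ℕ → ℝ}

theorem measurable_history (x : ℕ → Ω → Rd d) {k t : ℕ} (hk : 1 ≤ k) (hkt : k ≤ t) :
    Measurable[history x t] (x k) := by
  have h : MeasurableSpace.comap (x k) inferInstance ≤ history x t :=
    le_iSup₂_of_le k (Finset.mem_Icc.2 ⟨hk, hkt⟩) le_rfl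
  exact (comap_measurable (x k)).mono h le_rfl

/-- The logarithm of the exponential supermartingale of the method, with step sizes `α`. -/
noncomputable def logSupermartingale (G : Rd d → Rd d) (m : Rd d → ℝ) (C : ℝ) (α : ℕ → ℝ)
    (x : ℕ → Ω → Rd d) (t : ℕ) (ω : Ω) : ℝ :=
  ∑ k ∈ Finset.Icc 1 t, (inner ℝ (x (k + 1) ω - x k ω) (G (x k ω)) + α k * m (x k ω)
    - (α k * C * ‖G (x k ω)‖) ^ 2 / 2)

theorem measurable_logSupermartingale [MeasurableSpace Ω] {G : Rd d → Rd d} {m : Rd d → ℝ} {C : ℝ}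
    (hG : Measurable G) (hm : Measurable m) {t : ℕ}
    (hx : ∀ k, 1 ≤ k → k ≤ t + 1 → Measurable (x k)) :
    Measurable (logSupermartingale G m C α x t) := by
  unfold logSupermartingale
  refine Finset.measurable_fun_sum _ fun k hk => ?_
  rw [Finset.mem_Icc] at hk
  have h1 := hx k hk.1 (by omega)
  have h2 := hx (k + 1) (by omega) (by omega)
  fun_prop

/-- The sum up to `t` involves `x (t + 1)`, so it is known at time `t + 1`, just before the noise of
that step is drawn. -/
theorem measurable_history_logSupermartingale {G : Rd d → Rd d} {m : Rd d → ℝ} {C : ℝ}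
    (hG : Measurable G) (hm : Measurable m) (x : ℕ → Ω → Rd d) (t : ℕ) :
    Measurable[history x (t + 1)] (logSupermartingale G m C α x t) := by
  let _ := history x (t + 1)
  exact measurable_logSupermartingale hG hm fun k hk hkt => measurable_history x hk hkt

end History

/-! ### The exponential supermartingale -/

section Supermartingale

open ProbabilityTheory

variable {d : ℕ} {Ω Ξ : Type*} [MeasurableSpace Ω] {μ : Measure Ω}
  {P : Rd d → Rd d → ℝ} {Ψ : Rd d → Rd d} {F : Rd d → ℝ} {f : Rd d → Ξ → ℝ} {ξ : ℕ → Ω → Ξ}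
  {x : ℕ → Ω → Rd d} {α : ℕ → ℝ} {x₁ : Rd d} {L : ℝ}

theorem IsSmoothCost.lipschitzWith (hF : IsSmoothCost F L) :
    LipschitzWith L.toNNReal (gradient F) :=
  LipschitzWith.of_dist_le_mul fun u v => by
    rw [dist_eq_norm, dist_eq_norm]
    exact (hF.lipschitz u v).trans
      (mul_le_mul_of_nonneg_right (Real.le_coe_toNNReal L) (norm_nonneg _))

theorem HasNoiseDensity.measurable_iterate (hx : IsNSGD f ξ Ψ α x₁ x) (hm : Measurable Ψ)
    (hN : HasNoiseDensity μ F f ξ x P) {k : ℕ} (hk : 1 ≤ k) : Measurable (x k) := by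
  induction k, hk using Nat.le_induction with
  | base =>
    have : x 1 = fun _ => x₁ := funext hx.init
    rw [this]
    exact measurable_const
  | succ k hk ih =>
    have : x (k + 1) = fun ω => x k ω - α k • Ψ (stochGrad f (x k ω) (ξ k ω)) :=
      funext (hx.step k hk)
    rw [this]
    exact ih.sub ((hm.comp (hN.measurable k hk)).const_smul (α k))

theorem HasNoiseDensity.history_le (hx : IsNSGD f ξ Ψ α x₁ x) (hm : Measurable Ψ)
    (hN : HasNoiseDensity μ F f ξ x P) (t : ℕ) : history x t ≤ ‹MeasurableSpace Ω› :=
  iSup₂_le fun _ hk => (hN.measurable_iterate hx hm (Finset.mem_Icc.1 hk).1).comap_le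

/-- The joint law of a statistic of the past that determines the current state, and of the current
noise. -/
theorem HasNoiseDensity.map_prodMk [IsProbabilityMeasure μ] (hP : IsSymmetricNoiseDensity P)
    (hx : IsNSGD f ξ Ψ α x₁ x) (hm : Measurable Ψ) (hG : Measurable (gradient F))
    (hN : HasNoiseDensity μ F f ξ x P) {t : ℕ} (ht : 1 ≤ t) {S : Type*} [MeasurableSpace S]
    {V : Ω → S} (hV : Measurable[history x t] V) {π : S → Rd d} (hπ : Measurable π)
    (hπV : ∀ ω, π (V ω) = x t ω) :
    μ.map (fun ω => (V ω, stochGrad f (x t ω) (ξ t ω) - gradient F (x t ω))) =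
      (μ.map V).compProd ((noiseKernel P).comap π hπ) := by
  have := isMarkovKernel_noiseKernel hP
  have hle := hN.history_le hx hm t
  have hV' : Measurable V := hV.mono hle le_rfl
  have hxt := hN.measurable_iterate hx hm ht
  have hZ : Measurable fun ω => stochGrad f (x t ω) (ξ t ω) - gradient F (x t ω) :=
    (hN.measurable t ht).sub (hG.comp hxt)
  have : IsProbabilityMeasure (μ.map V) := Measure.isProbabilityMeasure_map hV'.aemeasurable
  have : IsProbabilityMeasure
      (μ.map (fun ω => (V ω, stochGrad f (x t ω) (ξ t ω) - gradient F (x t ω)))) :=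
    Measure.isProbabilityMeasure_map (hV'.prodMk hZ).aemeasurable
  -- On a rectangle the identity is the conditional density integrated over a past event.
  refine Measure.ext_prod fun {s B} hs hB => ?_
  have hpre : MeasurableSet[history x t] (V ⁻¹' s) := hV hs
  set A := {ω | stochGrad f (x t ω) (ξ t ω) - gradient F (x t ω) ∈ B} with hA
  have hAm : MeasurableSet A := hZ hB
  rw [Measure.map_apply (hV'.prodMk hZ) (hs.prod hB), Measure.compProd_apply_prod hs hB,
    setLIntegral_map hs (Kernel.measurable_coe _ hB) hV']
  simp only [Kernel.comap_apply, hπV, noiseKernel_apply_set hP _ hB]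
  have hcond := hN.condDensity t ht B hB
  rw [← ofReal_integral_eq_lintegral_ofReal
    ((integrable_condExp.congr hcond).integrableOn)
    (Filter.Eventually.of_forall fun ω => integral_nonneg (hP.nonneg _)),
    ← setIntegral_congr_ae (hle _ hpre) (hcond.mono fun ω h _ => h),
    setIntegral_condExp hle ((integrable_const 1).indicator hAm) hpre,
    setIntegral_indicator hAm, setIntegral_const, smul_eq_mul, mul_one, ofReal_measureReal]
  rfl

/-- Conditioning on the past: the current noise may be integrated out first. -/
theorem HasNoiseDensity.lintegral_comp_prodMk [IsProbabilityMeasure μ]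
    (hP : IsSymmetricNoiseDensity P)
    (hx : IsNSGD f ξ Ψ α x₁ x) (hm : Measurable Ψ) (hG : Measurable (gradient F))
    (hN : HasNoiseDensity μ F f ξ x P) {t : ℕ} (ht : 1 ≤ t) {S : Ω → ℝ}
    (hS : Measurable[history x t] S) {H : (Rd d × ℝ) × Rd d → ENNReal} (hH : Measurable H) :
    ∫⁻ ω, H ((x t ω, S ω), stochGrad f (x t ω) (ξ t ω) - gradient F (x t ω)) ∂μ =
      ∫⁻ ω, ∫⁻ z, H ((x t ω, S ω), z) ∂noiseKernel P (x t ω) ∂μ := by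
  have := isMarkovKernel_noiseKernel hP
  have hV : Measurable[history x t] fun ω => (x t ω, S ω) :=
    (measurable_history x ht le_rfl).prodMk hS
  have hV' : Measurable fun ω => (x t ω, S ω) := hV.mono (hN.history_le hx hm t) le_rfl
  have hxt := hN.measurable_iterate hx hm ht
  have hZ : Measurable fun ω => stochGrad f (x t ω) (ξ t ω) - gradient F (x t ω) :=
    (hN.measurable t ht).sub (hG.comp hxt)
  rw [← lintegral_map hH (hV'.prodMk hZ),
    hN.map_prodMk hP hx hm hG ht hV measurable_fst fun ω => rfl, Measure.lintegral_compProd hH,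
    lintegral_map hH.lintegral_kernel_prod_right' hV']
  rfl

/-- Integrating out the newest noise multiplies by at most one: the mean in Hoeffding's bound pays
for the drift `α * m`, and its variance proxy is exactly the subtracted square. -/
theorem lintegral_exp_logSupermartingale_le_one [IsProbabilityMeasure μ]
    (hP : IsSymmetricNoiseDensity P)
    (hx : IsNSGD f ξ Ψ α x₁ x) (hm : Measurable Ψ) {C : ℝ} (hb : ∀ y, ‖Ψ y‖ ≤ C)
    (hα : ∀ k, 0 ≤ α k) (hG : Measurable (gradient F))
    (hN : HasNoiseDensity μ F f ξ x P) {m : Rd d → ℝ} (hmm : Measurable m)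
    (hlow : ∀ u, m u ≤ inner ℝ (denoised P Ψ u (gradient F u)) (gradient F u)) (t : ℕ) :
    ∫⁻ ω, ENNReal.ofReal (Real.exp (logSupermartingale (gradient F) m C α x t ω)) ∂μ ≤ 1 := by
  induction t with
  | zero => simp [logSupermartingale]
  | succ t ih =>
    refine le_trans ?_ ih
    have ht : 1 ≤ t + 1 := Nat.le_add_left 1 t
    generalize hSdef : logSupermartingale (gradient F) m C α x t = S
    have hS : Measurable[history x (t + 1)] S :=
      hSdef ▸ measurable_history_logSupermartingale hG hmm x t
    -- The new summand splits into `c`, fixed by the current state, and `e`, which carries the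
    -- noise.
    obtain ⟨c, hc⟩ : ∃ c : Rd d → ℝ, c = fun u =>
      α (t + 1) * m u - (α (t + 1) * C * ‖gradient F u‖) ^ 2 / 2 := ⟨_, rfl⟩
    obtain ⟨e, he⟩ : ∃ e : Rd d → Rd d → ℝ, e = fun u z =>
      -α (t + 1) * inner ℝ (Ψ (gradient F u + z)) (gradient F u) := ⟨_, rfl⟩
    have hcm : Measurable c := by rw [hc]; fun_prop
    have hem : Measurable fun q : Rd d × Rd d => e q.1 q.2 := by rw [he]; fun_prop
    have hHm : Measurable fun q : (Rd d × ℝ) × Rd d =>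
        ENNReal.ofReal (Real.exp (q.1.2 + c q.1.1)) * ENNReal.ofReal (Real.exp (e q.1.1 q.2)) := by
      have h1 : Measurable fun q : (Rd d × ℝ) × Rd d => e q.1.1 q.2 :=
        hem.comp ((measurable_fst.comp measurable_fst).prodMk measurable_snd)
      have h2 : Measurable fun q : (Rd d × ℝ) × Rd d => q.1.2 + c q.1.1 :=
        (measurable_snd.comp measurable_fst).add (hcm.comp (measurable_fst.comp measurable_fst))
      exact h2.exp.ennreal_ofReal.mul h1.exp.ennreal_ofReal
    have hrec : ∀ ω, ENNReal.ofReal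
          (Real.exp (logSupermartingale (gradient F) m C α x (t + 1) ω)) =
        ENNReal.ofReal (Real.exp (S ω + c (x (t + 1) ω))) * ENNReal.ofReal (Real.exp
          (e (x (t + 1) ω) (stochGrad f (x (t + 1) ω) (ξ (t + 1) ω) -
            gradient F (x (t + 1) ω)))) := by
      intro ω
      have h1 : logSupermartingale (gradient F) m C α x (t + 1) ω = S ω +
          (inner ℝ (x (t + 1 + 1) ω - x (t + 1) ω) (gradient F (x (t + 1) ω))
            + α (t + 1) * m (x (t + 1) ω)
            - (α (t + 1) * C * ‖gradient F (x (t + 1) ω)‖) ^ 2 / 2) := by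
        rw [← hSdef, logSupermartingale, Finset.sum_Icc_succ_top ht, logSupermartingale]
      rw [← ENNReal.ofReal_mul (Real.exp_nonneg _), ← Real.exp_add, h1, hx.step (t + 1) ht,
        hc, he]
      simp only [add_sub_cancel, sub_sub_cancel_left, inner_neg_left, real_inner_smul_left]
      congr 2
      ring
    simp only [hrec]
    rw [hN.lintegral_comp_prodMk hP hx hm hG ht hS hHm]
    refine lintegral_mono fun ω => ?_
    generalize x (t + 1) ω = u
    have hem' : Measurable fun z => ENNReal.ofReal (Real.exp (e u z)) :=
      (hem.comp measurable_prodMk_left).exp.ennreal_ofReal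
    dsimp only
    rw [lintegral_const_mul _ hem']
    have hstep := lintegral_exp_noiseKernel_le hP hm hb (hα (t + 1)) u (gradient F u)
    rw [he]
    refine (mul_le_mul_right hstep _).trans ?_
    rw [← ENNReal.ofReal_mul (Real.exp_nonneg _), ← Real.exp_add]
    refine ENNReal.ofReal_le_ofReal (Real.exp_le_exp.2 ?_)
    have := mul_le_mul_of_nonneg_left (hlow u) (hα (t + 1))
    rw [hc]
    linarith

end Supermartingale

/-! ### Pathwise estimates -/

section Deterministic

variable {d : ℕ} {F : Rd d → ℝ} {L : ℝ}

/-- The descent lemma for functions with Lipschitz gradient. -/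
theorem IsSmoothCost.le_add_inner_add_sq (hF : IsSmoothCost F L) (u v : Rd d) :
    F v ≤ F u + inner ℝ (v - u) (gradient F u) + L / 2 * ‖v - u‖ ^ 2 := by
  set w := v - u with hw
  -- Along the segment, `F` minus its quadratic upper model has nonpositive derivative by the
  -- Lipschitz bound; compare `s = 0` and `s = 1`.
  let h : ℝ → ℝ := fun s => F (u + s • w) - s * inner ℝ w (gradient F u) - L / 2 * s ^ 2 * ‖w‖ ^ 2
  have hder : ∀ s, HasDerivAt h
      (inner ℝ (gradient F (u + s • w)) w - inner ℝ w (gradient F u) - L * s * ‖w‖ ^ 2) s := by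
    intro s
    have h1 : HasDerivAt (fun s : ℝ => u + s • w) w s := by
      simpa using ((hasDerivAt_id s).smul_const w).const_add u
    have h2 := (hF.differentiable (u + s • w)).hasGradientAt.hasFDerivAt.comp_hasDerivAt s h1
    have h3 := (hasDerivAt_id s).mul_const (inner ℝ w (gradient F u))
    have h4 := (((hasDerivAt_id s).pow 2).const_mul (L / 2)).mul_const (‖w‖ ^ 2)
    refine ((h2.sub h3).sub h4).congr_deriv ?_
    rw [InnerProductSpace.toDual_apply_apply]
    simp only [Nat.cast_ofNat, id_eq]
    ring
  have hanti : AntitoneOn h (Set.Icc 0 1) := by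
    refine antitoneOn_of_deriv_nonpos (convex_Icc 0 1)
      (fun s _ => (hder s).continuousAt.continuousWithinAt)
      (fun s _ => (hder s).differentiableAt.differentiableWithinAt) fun s hs => ?_
    rw [interior_Icc] at hs
    rw [(hder s).deriv, real_inner_comm (gradient F u) w, ← inner_sub_left]
    have h1 := real_inner_le_norm (gradient F (u + s • w) - gradient F u) w
    have h2 := hF.lipschitz (u + s • w) u
    rw [add_sub_cancel_left, norm_smul, Real.norm_of_nonneg hs.1.le] at h2
    have h3 := mul_le_mul_of_nonneg_right h2 (norm_nonneg w)
    nlinarith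
  have h01 := hanti (Set.left_mem_Icc.2 zero_le_one) (Set.right_mem_Icc.2 zero_le_one) zero_le_one
  have hv : u + w = v := by rw [hw]; abel
  simp only [h, one_smul, zero_smul, add_zero, hv] at h01
  linarith

/-- Bernoulli's inequality for an exponent in `[0, 1]`; with `p = 1 - η` it makes the step sizes
telescope. -/
theorem mul_rpow_neg_le_rpow_sub_rpow {p s : ℝ} (hp0 : 0 ≤ p) (hp1 : p ≤ 1) (hs : 1 ≤ s) :
    p / s ^ (1 - p) ≤ s ^ p - (s - 1) ^ p := by
  have hs0 : 0 < s := by linarith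
  have h1 : (1 + -(1 / s)) ^ p ≤ 1 + p * -(1 / s) :=
    rpow_one_add_le_one_add_mul_self
      (by rw [neg_le_neg_iff, div_le_one hs0]; exact hs) hp0 hp1
  have h2 : (s - 1) ^ p = s ^ p * (1 + -(1 / s)) ^ p := by
    rw [← Real.mul_rpow hs0.le]
    · congr 1; field_simp; ring
    · have : 1 / s ≤ 1 := (div_le_one hs0).2 hs
      linarith
  have h3 : p / s ^ (1 - p) = s ^ p * (p * (1 / s)) := by
    rw [Real.rpow_sub hs0, Real.rpow_one]
    have := (Real.rpow_pos_of_pos hs0 p).ne'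
    field_simp
  rw [h2, h3]
  nlinarith [mul_le_mul_of_nonneg_left h1 (Real.rpow_nonneg hs0.le p)]

variable {y : ℕ → Rd d} {a η C : ℝ}

/-- Growth of the gradient norm along a path with steps of size at most `a (k + 1) ^ (-η) C`. -/
theorem IsSmoothCost.norm_gradient_le (hF : IsSmoothCost F L) (hL : 0 < L) (ha : 0 < a)
    (hC : 0 < C) (hη0 : 0 ≤ η) (hη1 : η < 1)
    (hstep : ∀ k, 1 ≤ k → ‖y (k + 1) - y k‖ ≤ a / ((k : ℝ) + 1) ^ η * C) {k : ℕ} (hk : 1 ≤ k) :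
    ‖gradient F (y k)‖ ≤ ‖gradient F (y 1)‖ + L * C * a * (k : ℝ) ^ (1 - η) / (1 - η) := by
  have hη : 0 < 1 - η := by linarith
  induction k, hk using Nat.le_induction with
  | base =>
    have : 0 ≤ L * C * a * ((1 : ℕ) : ℝ) ^ (1 - η) / (1 - η) := by positivity
    linarith
  | succ k hk ih =>
    have h1 := hF.lipschitz (y (k + 1)) (y k)
    have h2 := mul_le_mul_of_nonneg_left (hstep k hk) hL.le
    have h3 := norm_le_norm_add_norm_sub' (gradient F (y (k + 1))) (gradient F (y k))
    have h4 := mul_rpow_neg_le_rpow_sub_rpow (p := 1 - η) (s := (k : ℝ) + 1) hη.le (by linarith)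
      (by linarith [(Nat.cast_nonneg k : (0 : ℝ) ≤ k)])
    rw [sub_sub_cancel, add_sub_cancel_right] at h4
    have h5 : L * (a / ((k : ℝ) + 1) ^ η * C) ≤
        L * C * a * (((k : ℝ) + 1) ^ (1 - η) - (k : ℝ) ^ (1 - η)) / (1 - η) := by
      rw [le_div_iff₀ hη]
      calc L * (a / ((k : ℝ) + 1) ^ η * C) * (1 - η)
          = L * C * a * ((1 - η) / ((k : ℝ) + 1) ^ η) := by ring
        _ ≤ _ := by gcongr
    push_cast
    have h6 : L * C * a * (((k : ℝ) + 1) ^ (1 - η) - (k : ℝ) ^ (1 - η)) / (1 - η) =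
        L * C * a * ((k : ℝ) + 1) ^ (1 - η) / (1 - η) - L * C * a * (k : ℝ) ^ (1 - η) / (1 - η) := by
      ring
    linarith

/-- The growth `k ^ (1 - η)` of the gradient is absorbed by the step size because `1 - η ≤ η`, and
`a ≤ 1` absorbs the second factor `a`. -/
theorem IsSmoothCost.step_mul_norm_gradient_le (hF : IsSmoothCost F L) (hL : 0 < L) (ha : 0 < a)
    (ha1 : a ≤ 1) (hC : 0 < C) (hη0 : 1 / 2 ≤ η) (hη1 : η < 1)
    (hstep : ∀ k, 1 ≤ k → ‖y (k + 1) - y k‖ ≤ a / ((k : ℝ) + 1) ^ η * C) {k : ℕ} (hk : 1 ≤ k) :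
    a / ((k : ℝ) + 1) ^ η * ‖gradient F (y k)‖ ≤
      a * (L * C + (1 - η) * ‖gradient F (y 1)‖) / (1 - η) := by
  have hη : 0 < 1 - η := by linarith
  have hk1 : (1 : ℝ) ≤ k := by exact_mod_cast hk
  have hden : 1 ≤ ((k : ℝ) + 1) ^ η := Real.one_le_rpow (by linarith) (by linarith)
  have hkη : (k : ℝ) ^ (1 - η) ≤ ((k : ℝ) + 1) ^ η :=
    (Real.rpow_le_rpow_of_exponent_le hk1 (by linarith)).trans
      (Real.rpow_le_rpow (by linarith) (by linarith) (by linarith))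
  have hg := hF.norm_gradient_le hL ha hC (by linarith) hη1 hstep hk
  have hn := norm_nonneg (gradient F (y 1))
  rw [div_mul_eq_mul_div, div_le_iff₀ (by linarith)]
  have h1 : L * C * a * (k : ℝ) ^ (1 - η) ≤ L * C * 1 * ((k : ℝ) + 1) ^ η := by gcongr
  have h2 : ‖gradient F (y 1)‖ * 1 ≤ ‖gradient F (y 1)‖ * ((k : ℝ) + 1) ^ η := by gcongr
  have h3 : L * C * a * (k : ℝ) ^ (1 - η) / (1 - η) ≤ L * C * 1 * ((k : ℝ) + 1) ^ η / (1 - η) := by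
    gcongr
  calc a * ‖gradient F (y k)‖
      ≤ a * (‖gradient F (y 1)‖ * ((k : ℝ) + 1) ^ η +
          L * C * 1 * ((k : ℝ) + 1) ^ η / (1 - η)) := by
        gcongr; linarith
    _ = _ := by field_simp; ring

/-- Lets the variance proxy be paid for by half of the drift; each hypothesis handles one branch of
the minimum. -/
theorem sq_half_le_half_mul_min {α g β₁ β₂ : ℝ} (hα : 0 ≤ α) (hg : 0 ≤ g)
    (h₁ : C ^ 2 * (α * g) ≤ β₁) (h₂ : C ^ 2 * α ≤ β₂) :
    (α * C * g) ^ 2 / 2 ≤ α * min (β₁ * g) (β₂ * g ^ 2) / 2 := by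
  have h : C ^ 2 * α * g ^ 2 ≤ min (β₁ * g) (β₂ * g ^ 2) :=
    le_min (by nlinarith [mul_le_mul_of_nonneg_right h₁ hg])
      (mul_le_mul_of_nonneg_right h₂ (sq_nonneg g))
  nlinarith [mul_le_mul_of_nonneg_left h hα]

theorem mul_min_le_min {β₁ β₂ g : ℝ} (hg : 0 ≤ g) (h₁ : 0 ≤ β₁) (h₂ : 0 ≤ β₂) :
    min β₁ β₂ * min g (g ^ 2) ≤ min (β₁ * g) (β₂ * g ^ 2) := by
  have hβ : 0 ≤ min β₁ β₂ := le_min h₁ h₂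
  exact le_min (mul_le_mul (min_le_left _ _) (min_le_left _ _) (le_min hg (sq_nonneg g)) h₁)
    (mul_le_mul (min_le_right _ _) (min_le_right _ _) (le_min hg (sq_nonneg g)) h₂)

/-- The descent lemma, telescoped over the steps. -/
theorem IsSmoothCost.sum_inner_ge (hF : IsSmoothCost F L) (hL : 0 < L) {α : ℕ → ℝ}
    (hstep : ∀ k, 1 ≤ k → ‖y (k + 1) - y k‖ ≤ α k * C) (t : ℕ) :
    F (y (t + 1)) - F (y 1) - L * C ^ 2 / 2 * ∑ k ∈ Finset.Icc 1 t, α k ^ 2 ≤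
      ∑ k ∈ Finset.Icc 1 t, inner ℝ (y (k + 1) - y k) (gradient F (y k)) := by
  induction t with
  | zero => simp
  | succ t ih =>
    rw [Finset.sum_Icc_succ_top (by omega), Finset.sum_Icc_succ_top (by omega)]
    have h1 := hF.le_add_inner_add_sq (y (t + 1)) (y (t + 1 + 1))
    have h2 := pow_le_pow_left₀ (norm_nonneg _) (hstep (t + 1) (by omega)) 2
    have h3 := mul_le_mul_of_nonneg_left h2 (by positivity : 0 ≤ L / 2)
    nlinarith

/-- The rate on the event where the supermartingale is small, along a single path. -/
theorem IsSmoothCost.average_le (hF : IsSmoothCost F L) (hL : 0 < L) (ha : 0 < a)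
    (hC : 0 < C) (hη0 : 1 / 2 ≤ η) (hη1 : η < 1) {β₁ β₂ : ℝ} (hβ₁ : 0 < β₁) (hβ₂ : 0 < β₂)
    (hale : a ≤ min 1 (min (β₂ / (8 * C ^ 2))
      ((1 - η) * β₁ / (8 * C ^ 2 * (L * C + (1 - η) * ‖gradient F (y 1)‖)))))
    (hstep : ∀ k, 1 ≤ k → ‖y (k + 1) - y k‖ ≤ a / ((k : ℝ) + 1) ^ η * C)
    {t : ℕ} (ht : 1 ≤ t) {ℓ : ℝ} (hℓ0 : 0 ≤ ℓ)
    (hℓ : ∑ k ∈ Finset.Icc 1 t, (inner ℝ (y (k + 1) - y k) (gradient F (y k))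
      + a / ((k : ℝ) + 1) ^ η *
        min (β₁ * ‖gradient F (y k)‖) (β₂ * ‖gradient F (y k)‖ ^ 2)
      - (a / ((k : ℝ) + 1) ^ η * C * ‖gradient F (y k)‖) ^ 2 / 2) ≤ ℓ) :
    (1 / (t : ℝ)) * ∑ k ∈ Finset.Icc 1 t, min ‖gradient F (y k)‖ (‖gradient F (y k)‖ ^ 2) ≤
      4 * (ℓ + (F (y 1) - ⨅ u, F u)) / (a * min β₁ β₂ * (t : ℝ) ^ (1 - η))
        + 2 * a * L * C ^ 2 / (min β₁ β₂ * (t : ℝ) ^ (1 - η))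
          * ∑ k ∈ Finset.Icc 1 t, ((k : ℝ) + 1) ^ (-2 * η) := by
  have hη : 0 < 1 - η := by linarith
  have ha1 : a ≤ 1 := hale.trans (min_le_left _ _)
  have ha2 : a ≤ β₂ / (8 * C ^ 2) := hale.trans ((min_le_right _ _).trans (min_le_left _ _))
  have ha3 := hale.trans ((min_le_right _ _).trans (min_le_right _ _))
  rw [le_div_iff₀ (by positivity)] at ha2
  have hQ : 0 < L * C + (1 - η) * ‖gradient F (y 1)‖ := by positivity
  set Q := L * C + (1 - η) * ‖gradient F (y 1)‖ with hQdef
  rw [le_div_iff₀ (by positivity)] at ha3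
  set g : ℕ → ℝ := fun k => ‖gradient F (y k)‖ with hg
  have hg0 : ∀ k, 0 ≤ g k := fun k => norm_nonneg _
  set α : ℕ → ℝ := fun k => a / ((k : ℝ) + 1) ^ η with hαdef
  have hden : ∀ k : ℕ, 1 ≤ ((k : ℝ) + 1) ^ η := fun k =>
    Real.one_le_rpow (by linarith [(Nat.cast_nonneg k : (0 : ℝ) ≤ k)]) (by linarith)
  have hα0 : ∀ k, 0 < α k := fun k => div_pos ha (by linarith [hden k])
  have hαa : ∀ k, α k ≤ a := fun k => div_le_self ha.le (hden k)
  set m : ℕ → ℝ := fun k => min (β₁ * g k) (β₂ * g k ^ 2) with hm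
  have hβ : 0 < min β₁ β₂ := lt_min hβ₁ hβ₂
  set β := min β₁ β₂ with hβdef
  -- The restriction on `a` gives both conditions with a factor `8` to spare.
  have hvar : ∀ k ∈ Finset.Icc 1 t, (α k * C * g k) ^ 2 / 2 ≤ α k * m k / 2 := by
    intro k hk
    have h1 := hF.step_mul_norm_gradient_le hL ha ha1 hC hη0 hη1 hstep (Finset.mem_Icc.1 hk).1
    rw [← hQdef, le_div_iff₀ hη] at h1
    refine sq_half_le_half_mul_min (hα0 k).le (hg0 k) ?_ ?_
    · have h2 : C ^ 2 * (α k * g k) * (1 - η) ≤ β₁ * (1 - η) := by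
        have h3 := mul_le_mul_of_nonneg_left h1 (sq_nonneg C)
        have h4 : 0 ≤ a * (C ^ 2 * Q) := by positivity
        simp only [hαdef, hg]
        linarith
      exact le_of_mul_le_mul_right h2 hη
    · have h3 := mul_le_mul_of_nonneg_left (hαa k) (sq_nonneg C)
      have h4 : 0 ≤ a * C ^ 2 := by positivity
      linarith
  have hdesc := hF.sum_inner_ge hL (α := α) hstep t
  have hinf : ⨅ u, F u ≤ F (y (t + 1)) := ciInf_le hF.bddBelow _
  have hΔ : 0 ≤ F (y 1) - ⨅ u, F u := sub_nonneg.2 (ciInf_le hF.bddBelow _)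
  set Δ := F (y 1) - ⨅ u, F u with hΔdef
  have hsum : ∑ k ∈ Finset.Icc 1 t, α k * m k ≤
      2 * (ℓ + Δ) + L * C ^ 2 * ∑ k ∈ Finset.Icc 1 t, α k ^ 2 := by
    have h1 : ∑ k ∈ Finset.Icc 1 t, (inner ℝ (y (k + 1) - y k) (gradient F (y k))
        + α k * m k / 2) ≤ ℓ :=
      (Finset.sum_le_sum fun k hk => by linarith [hvar k hk]).trans hℓ
    rw [Finset.sum_add_distrib, ← Finset.sum_div] at h1
    linarith
  have ht1 : (1 : ℝ) ≤ t := by exact_mod_cast ht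
  have ht0 : (0 : ℝ) < t := by linarith
  set M := ∑ k ∈ Finset.Icc 1 t, min (g k) (g k ^ 2) with hM
  -- Step sizes decrease, so the last one bounds all the weights from below.
  have hlow : α t * β * M ≤ ∑ k ∈ Finset.Icc 1 t, α k * m k := by
    rw [hM, Finset.mul_sum]
    refine Finset.sum_le_sum fun k hk => ?_
    have hkt : (k : ℝ) ≤ t := by exact_mod_cast (Finset.mem_Icc.1 hk).2
    have h1 : α t ≤ α k := by
      have := hden k
      refine div_le_div_of_nonneg_left ha.le (by linarith) ?_
      exact Real.rpow_le_rpow (by positivity) (by linarith) (by linarith)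
    rw [mul_assoc]
    exact mul_le_mul h1 (mul_min_le_min (hg0 k) hβ₁.le hβ₂.le)
      (mul_nonneg hβ.le (le_min (hg0 k) (sq_nonneg _))) (hα0 k).le
  set T := ∑ k ∈ Finset.Icc 1 t, ((k : ℝ) + 1) ^ (-2 * η) with hT
  have hT0 : 0 ≤ T := Finset.sum_nonneg fun k _ => by positivity
  have hsq : ∑ k ∈ Finset.Icc 1 t, α k ^ 2 = a ^ 2 * T := by
    rw [hT, Finset.mul_sum]
    refine Finset.sum_congr rfl fun k _ => ?_
    have hk0 : (0 : ℝ) ≤ (k : ℝ) + 1 := by positivity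
    rw [hαdef, show -2 * η = -(η * 2) by ring, Real.rpow_neg hk0, Real.rpow_mul hk0]
    simp only [div_pow]
    norm_num [div_eq_mul_inv]
  rw [hsq] at hsum
  -- This trades `1 / α t`, divided by `t`, for the rate `t ^ (1 - η)` at the cost of a factor `2`,
  -- which turns the constants `2` and `1` of `R` into `4` and `2`.
  have hpow : ((t : ℝ) + 1) ^ η * (t : ℝ) ^ (1 - η) ≤ 2 * t := by
    calc ((t : ℝ) + 1) ^ η * (t : ℝ) ^ (1 - η) ≤ (2 * t) ^ η * (t : ℝ) ^ (1 - η) := by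
          gcongr; linarith
      _ = 2 ^ η * t := by
          rw [Real.mul_rpow (by norm_num) ht0.le, mul_assoc, ← Real.rpow_add ht0,
            add_sub_cancel, Real.rpow_one]
      _ ≤ 2 ^ (1 : ℝ) * t := by
          gcongr
          exact one_le_two
      _ = 2 * t := by rw [Real.rpow_one]
  set p := (t : ℝ) ^ (1 - η) with hp
  have hp0 : 0 < p := Real.rpow_pos_of_pos ht0 _
  have hq0 : 0 < ((t : ℝ) + 1) ^ η := by linarith [hden t]
  set q := ((t : ℝ) + 1) ^ η with hq
  set R := 2 * (ℓ + Δ) + L * C ^ 2 * (a ^ 2 * T) with hR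
  have hR0 : 0 ≤ R := by positivity
  have hmain : a * β * M ≤ q * R := by
    have h1 : α t * β * M ≤ R := hlow.trans hsum
    have h2 : α t * β * M = a * β * M / q := by
      simp only [hαdef]
      ring
    rw [h2, div_le_iff₀ hq0] at h1
    linarith
  have hrhs : 4 * (ℓ + Δ) / (a * β * p) + 2 * a * L * C ^ 2 / (β * p) * T =
      2 * R / (a * β * p) := by
    rw [hR]; field_simp; ring
  rw [hrhs, one_div_mul_eq_div, div_le_div_iff₀ ht0 (by positivity)]
  calc M * (a * β * p) = a * β * M * p := by ring
    _ ≤ q * R * p := by gcongr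
    _ = R * (q * p) := by ring
    _ ≤ R * (2 * t) := by gcongr
    _ = _ := by ring

end Deterministic

theorem theorem1 {d : ℕ} (Ψ : Rd d → Rd d) (hΨ : IsSmoothComponentwise Ψ ∨ IsJoint Ψ)
    (P : Rd d → Rd d → ℝ) (hP : IsSymmetricNoiseDensity P)
    (hone : d = 1 → ¬ IsSmoothComponentwise Ψ →
      ∃ E₀ > 0, ∃ p > 0, ∀ x z, ‖z‖ ≤ E₀ → p ≤ P x z) :
    (∃ β₁ β₂ : ℝ, AreDenoisingConstants P Ψ β₁ β₂) ∧
    ∀ β₁ β₂ : ℝ, AreDenoisingConstants P Ψ β₁ β₂ →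
    ∀ C : ℝ, 0 < C → (∀ y, ‖Ψ y‖ ≤ C) →
    ∀ {Ω : Type*} [MeasurableSpace Ω] (μ : Measure Ω) [IsProbabilityMeasure μ]
      {Ξ : Type*} (f : Rd d → Ξ → ℝ) (ξ : ℕ → Ω → Ξ)
      (F : Rd d → ℝ) (L : ℝ) (x₁ : Rd d) (x : ℕ → Ω → Rd d) (a η : ℝ),
    0 < L → IsSmoothCost F L →
    1 / 2 ≤ η → η < 1 →
    0 < a →
    a ≤ min 1 (min (β₂ / (8 * C ^ 2))
      ((1 - η) * β₁ / (8 * C ^ 2 * (L * C + (1 - η) * ‖gradient F x₁‖)))) →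
    IsNSGD f ξ Ψ (fun t => a / ((t : ℝ) + 1) ^ η) x₁ x →
    HasNoiseDensity μ F f ξ x P →
    ∀ t : ℕ, 1 ≤ t → ∀ δ : ℝ, 0 < δ → δ < 1 →
      ENNReal.ofReal (1 - δ) ≤
        μ {ω | (1 / (t : ℝ)) * ∑ k ∈ Finset.Icc 1 t,
              min ‖gradient F (x k ω)‖ (‖gradient F (x k ω)‖ ^ 2)
            ≤ 4 * (Real.log (1 / δ) + (F x₁ - ⨅ y, F y)) / (a * min β₁ β₂ * (t : ℝ) ^ (1 - η))
              + 2 * a * L * C ^ 2 / (min β₁ β₂ * (t : ℝ) ^ (1 - η))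
                * ∑ k ∈ Finset.Icc 1 t, ((k : ℝ) + 1) ^ (-2 * η)} := by
  refine ⟨exists_areDenoisingConstants Ψ hΨ P hP hone, ?_⟩
  intro β₁ β₂ ⟨hβ₁, hβ₂, hβ⟩ C hC hb Ω _ μ _ Ξ f ξ F L x₁ x a η hL hF hη0 hη1 ha hale hx hN t ht
    δ hδ0 hδ1
  have hΨm := measurable_of_componentwise_or_joint hΨ
  have hG : Measurable (gradient F) := hF.lipschitzWith.continuous.measurable
  set α : ℕ → ℝ := fun t => a / ((t : ℝ) + 1) ^ η with hα
  have hα0 : ∀ k, 0 ≤ α k := fun k => by positivity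
  let m : Rd d → ℝ := fun u => min (β₁ * ‖gradient F u‖) (β₂ * ‖gradient F u‖ ^ 2)
  have hmm : Measurable m := by fun_prop
  set S := logSupermartingale (gradient F) m C α x t with hS
  have hint := lintegral_exp_logSupermartingale_le_one hP hx hΨm hb hα0 hG hN hmm
    (fun u => hβ u (gradient F u)) t
  have hSm : Measurable S :=
    measurable_logSupermartingale hG hmm fun k hk _ => hN.measurable_iterate hx hΨm hk
  have hWm : Measurable fun ω => ENNReal.ofReal (Real.exp (S ω)) := by fun_prop
  -- Markov's inequality at level `1 / δ`; off the exceptional event everything is deterministic.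
  have hmarkov := (mul_meas_ge_le_lintegral (μ := μ) hWm (ENNReal.ofReal (1 / δ))).trans hint
  set A := {ω | ENNReal.ofReal (1 / δ) ≤ ENNReal.ofReal (Real.exp (S ω))} with hA
  have hAm : MeasurableSet A := measurableSet_le measurable_const hWm
  have hμA : μ A ≤ ENNReal.ofReal δ := by
    have h1 : ENNReal.ofReal δ * (ENNReal.ofReal (1 / δ) * μ A) ≤ ENNReal.ofReal δ * 1 :=
      mul_le_mul_right hmarkov _
    rwa [← mul_assoc, ← ENNReal.ofReal_mul hδ0.le, mul_one_div_cancel hδ0.ne',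
      ENNReal.ofReal_one, one_mul, mul_one] at h1
  calc ENNReal.ofReal (1 - δ) = 1 - ENNReal.ofReal δ := by
        rw [ENNReal.ofReal_sub _ hδ0.le, ENNReal.ofReal_one]
    _ ≤ 1 - μ A := tsub_le_tsub_left hμA 1
    _ = μ Aᶜ := (prob_compl_eq_one_sub hAm).symm
    _ ≤ _ := measure_mono fun ω hω => ?_
  have hlt : S ω ≤ Real.log (1 / δ) := by
    have h1 : ENNReal.ofReal (Real.exp (S ω)) < ENNReal.ofReal (1 / δ) := not_le.1 hω
    rw [ENNReal.ofReal_lt_ofReal_iff (by positivity)] at h1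
    exact ((Real.lt_log_iff_exp_lt (by positivity)).2 h1).le
  have hinit := hx.init ω
  have hfinal := hF.average_le (y := fun k => x k ω) hL ha hC hη0 hη1 hβ₁ hβ₂
    (by simpa only [hinit] using hale)
    (fun k hk => by
      rw [hx.step k hk, sub_sub_cancel_left, norm_neg, norm_smul, Real.norm_of_nonneg (hα0 k)]
      exact mul_le_mul_of_nonneg_left (hb _) (hα0 k))
    ht (Real.log_nonneg ((one_le_div hδ0).2 hδ1.le)) hlt
  simpa only [hinit, Set.mem_ofPred_eq] using hfinal
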